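/- **Model.** For units $i=1,2,\dots$ and times $t$, let $y_{i,t}=\beta_i^{0\prime}x_{i,t}+\delta_i^{0\prime}w_{i,t}\mathbb 1\{q_{i,t}\le\gamma_i^0\}+e_{i,t}$, with $w_{i,t}=R'x_{i,t}\in\mathbb R^r$ for a fixed $K\times r$ matrix $R$ (the pure threshold model is $R=I_K$), $x_{i,t}=\Pi_i'f_t+\xi_{i,t}\in\mathbb R^K$, $e_{i,t}=\lambda_i'f_t+\varepsilon_{i,t}$, where $f_t\in\mathbb R^m$ are unobserved factors, the loadings $\Pi_i,\lambda_i$ are fixed, and $\beta_i^0,\delta_i^0,\gamma_i^0$ are fixed parameters. For a sample $i\le N$, $1\le t\le T$, let $F=(f_1,\dots,f_T)'$, let $X_i$ and $W_i(\gamma)$ be the matrices with rows $x_{i,t}'$ and $w_{i,t}'\mathbb 1\{q_{i,t}\le\gamma\}$, $y_i=(y_{i,1},\dots,y_{i,T})'$, $\bar X=N^{-1}\sum_{i\le N}X_i$, $\bar\Pi=N^{-1}\sum_{i\le N}\Pi_i$, and let $M_A$ be the matrix of the orthogonal projection onto the orthogonal complement of the column space of $A$ ($M_A=I-A(A'A)^{-1}A'$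 when $A'A$ is invertible). A tilde denotes premultiplication by $M_{\bar X}$, and $\tilde Z_i(\gamma)=(\tilde X_i,\tilde W_i(\gamma))$. **Estimator.** With $\hat\theta_i(\gamma)=(\tilde Z_i(\gamma)'\tilde Z_i(\gamma))^{-1}\tilde Z_i(\gamma)'\tilde y_i$, let $\hat\gamma_i$ be any minimiser over $\gamma\in\Gamma_i=[\underline\gamma_i,\overline\gamma_i]$ of $\|\tilde y_i-\tilde Z_i(\gamma)\hat\theta_i(\gamma)\|^2$. **Assumptions.** Write $\mathscr D=\sigma(F)$ and $E_{\mathscr D}=E(\cdot\mid\mathscr D)$; $\|\cdot\|$ is the Frobenius norm; $C$ is a finite constant; "uniformly" means uniformly in $i$. 1. $f_t$ is strictly stationary and ergodic; the process $(f_t)_t$ is independent of $(\varepsilon_{i,t})_{i,t}$ and of $(\xi_{i,t})_{i,t}$; $E\|f_t\|^{4+\epsilon}<\infty$ for some $\epsilon>0$; $T^{-1}F'F\to_p\Sigma_f>0$. 2. $\operatorname{rank}\bar\Pi=m\le K$ for all $N\ge1$, and every limit point of $\bar\Pi$ as $N\to\infty$ has rank $m$; $\sup_i\|\Pi_i\|\le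 C$, $\sup_i\|\lambda_i\|\le C$. 3. The processes $(\xi_{i,t})_t$ are independent across $i$; each is strictly stationary, ergodic and $\rho$-mixing with $\sum_{n\ge1}\rho_n^{1/2}<\infty$; $E(\xi_{i,t}\mid\sigma(\xi_{j,t-1},j\le N))=0$ for $i\le N$; $E\|\xi_{i,t}\|^{4+\epsilon}<\infty$ for some $\epsilon>0$; the covariance matrices are nonsingular and uniformly bounded, the fourth-order cumulants are uniformly bounded, and $\sup_i\sum_{s\in\mathbb Z}\|\mathrm{Cov}(\xi_{i,0},\xi_{i,s})\|\le C$. 4. The same holds for $\varepsilon_{i,t}$ in place of $\xi_{i,t}$ (with positive variances), and $(\varepsilon_{i,t})_{i,t}$ is independent of $(\xi_{i,t})_{i,t}$. 5. The threshold variable is exogenous: for each $i$, the process $(\varepsilon_{i,t})_t$ is independent of $\big((f_t)_t,(\xi_{j,t})_{j,t},(q_{i,t})_t\big)$. Given $\mathscr D$, $q_{i,t}$ has a conditional density that is continuous at $\gamma_i^0$ and bounded by $C$ on $\Gamma_i$, for all $i,t,T$. 6. $\delta_i^0\ne0$ for each $i$. With $S_{1i}(\gamma)=\tilde Z_i(\gamma)'\tilde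 Z_i(\gamma)$, $\tilde W_i(\gamma_i^0,\gamma)=\tilde W_i(\gamma_i^0)-\tilde W_i(\gamma)$, $S_{2i}(\gamma)=\tilde Z_i(\gamma)'\tilde W_i(\gamma_i^0,\gamma)$, $S_{3i}(\gamma)=\tilde W_i(\gamma_i^0,\gamma)'\tilde W_i(\gamma_i^0,\gamma)$, for each $i$ there is $\tau_i>0$ such that for every $\eta>0$ the probability that $\lambda_{\min}\big[T^{-1}\big(S_{3i}(\gamma)-S_{2i}(\gamma)'S_{1i}(\gamma)^{-1}S_{2i}(\gamma)\big)\big]\ge\tau_i\min(1,|\gamma-\gamma_i^0|)$ for all $\gamma\in\Gamma_i$ with $|\gamma-\gamma_i^0|\ge\eta$ tends to one as $(N,T)\to\infty$. 7. $\gamma_i^0\in\Gamma_i$, a compact interval. 8. For each $i$ and $\gamma\in\Gamma_i$, for all large $T$, almost surely the matrix with blocks $E_{\mathscr D}(T^{-1}X_i'M_FX_i)$, $E_{\mathscr D}(T^{-1}X_i'M_FW_i(\gamma))$, its transpose, and $E_{\mathscr D}(T^{-1}W_i(\gamma)'M_FW_i(\gamma))$ is positive definite; and the probability that $\tilde Z_i(\gamma)'\tilde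 Z_i(\gamma)>0$ for all $\gamma\in\Gamma_i$ tends to one as $(N,T)\to\infty$. 9. The squared norms of these three conditional expectations are, almost surely given the factors, bounded uniformly in $i$, $T$ and $\gamma\in\Gamma_i$, and $\|E(T^{-1}W_i(\gamma)'W_i(\gamma))\|^2\le C$ for all $i$, $T$ and $\gamma\in\Gamma_i$. **Theorem.** Under these assumptions, for each unit $i$, $\hat\gamma_i\to_p\gamma_i^0$ as $(N,T)\to\infty$ jointly, with no restriction on the relative rates of $N$ and $T$, and with threshold effects $\delta_i^0$ that do not shrink with the sample size. -/

import Mathlib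

open MeasureTheory ProbabilityTheory Filter Topology Matrix
open scoped ENNReal

noncomputable section

namespace PanelThreshold

/-! ### Matrix notions -/

/-- The Frobenius norm of a real matrix. -/
def frobNorm {a b : Type*} [Fintype a] [Fintype b] (A : Matrix a b ℝ) : ℝ :=
  Real.sqrt (∑ i, ∑ j, A i j ^ 2)

/-- The smallest eigenvalue of a real symmetric matrix (the minimum of its finite spectrum). -/
def lmin {a : Type*} [Fintype a] [DecidableEq a] (A : Matrix a a ℝ) : ℝ :=
  sInf (spectrum ℝ A)

/-- The projection matrix `M_A` off the column space of `A`, that is, the matrix of the orthogonal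
projection onto the orthogonal complement of the span of the columns of `A`. It is
`I - A (A'A)⁻¹ A'` whenever `A'A` is invertible, see `annihilator_eq`. -/
def annihilator {a b : Type*} [Fintype a] [DecidableEq a] [Fintype b] [DecidableEq b]
    (A : Matrix a b ℝ) : Matrix a a ℝ :=
  Matrix.toEuclideanLin.symm
    ((LinearMap.range (Matrix.toEuclideanLin A))ᗮ.starProjection : _ →ₗ[ℝ] EuclideanSpace ℝ a)

theorem annihilator_eq {a b : Type*} [Fintype a] [DecidableEq a] [Fintype b] [DecidableEq b]
    (A : Matrix a b ℝ) (h : IsUnit (Aᵀ * A).det) :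
    annihilator A = 1 - A * (Aᵀ * A)⁻¹ * Aᵀ := by
  rw [annihilator, LinearEquiv.symm_apply_eq]
  ext1 v
  refine Submodule.eq_starProjection_of_mem_of_inner_eq_zero ?_ ?_
  · rw [Submodule.mem_orthogonal]
    rintro _ ⟨w, rfl⟩
    have key : Aᵀ * (1 - A * (Aᵀ * A)⁻¹ * Aᵀ) = 0 := by
      rw [Matrix.mul_sub, Matrix.mul_one, ← Matrix.mul_assoc, ← Matrix.mul_assoc,
        Matrix.mul_nonsing_inv _ h, Matrix.one_mul, sub_self]
    simp only [Matrix.toLpLin_apply, EuclideanSpace.inner_eq_star_dotProduct, star_trivial]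
    rw [Matrix.dotProduct_mulVec, ← Matrix.mulVec_transpose, Matrix.mulVec_mulVec, key]
    simp
  · intro w hw
    rw [Submodule.mem_orthogonal] at hw
    have : v - (Matrix.toEuclideanLin (1 - A * (Aᵀ * A)⁻¹ * Aᵀ)) v
        = Matrix.toEuclideanLin A (WithLp.toLp 2 (((Aᵀ * A)⁻¹ * Aᵀ) *ᵥ v.ofLp)) := by
      ext j
      simp [Matrix.toLpLin_apply, Matrix.mul_assoc]
    rw [this]
    exact hw _ ⟨_, rfl⟩

/-! ### Stochastic processes indexed by `t ∈ ℤ` -/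

section Processes

variable {Ω : Type*} [MeasurableSpace Ω]

/-- `u` is strictly stationary and ergodic: the time shift preserves the law of the whole path,
and is ergodic for it. -/
def StationaryErgodic {E : Type*} [MeasurableSpace E] (μ : Measure Ω) (u : ℤ → Ω → E) : Prop :=
  Ergodic (fun (x : ℤ → E) t => x (t + 1)) (μ.map (fun ω t => u t ω))

/-- The `ρ`-mixing coefficient at lag `n`: the supremum of `|Cov(g, h)|` over square-integrable
`g`, measurable with respect to `σ(u_s, s ≤ k)`, and `h`, measurable with respect to
`σ(u_s, s ≥ k + n)`, both of variance at most one. -/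
def rhoMix {E : Type*} [MeasurableSpace E] (μ : Measure Ω) (u : ℤ → Ω → E) (n : ℕ) : ℝ :=
  sSup {c : ℝ | ∃ (k : ℤ) (g h : Ω → ℝ),
    Measurable[⨆ s : {s : ℤ // s ≤ k}, MeasurableSpace.comap (u s) inferInstance] g ∧
    Measurable[⨆ s : {s : ℤ // k + n ≤ s}, MeasurableSpace.comap (u s) inferInstance] h ∧
    MemLp g 2 μ ∧ MemLp h 2 μ ∧ variance g μ ≤ 1 ∧ variance h μ ≤ 1 ∧
    c = |covariance g h μ|}

/-- The fourth-order joint cumulant of four real random variables. -/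
def cumulant4 (μ : Measure Ω) (X Y Z W : Ω → ℝ) : ℝ :=
  (∫ ω, (X ω - μ[X]) * (Y ω - μ[Y]) * (Z ω - μ[Z]) * (W ω - μ[W]) ∂μ)
    - covariance X Y μ * covariance Z W μ
    - covariance X Z μ * covariance Y W μ
    - covariance X W μ * covariance Y Z μ

/-- The autocovariance matrix `Cov(u_0, u_s)` of a stationary vector process;
at `s = 0` it is the covariance matrix. -/
def autocov {K : ℕ} (μ : Measure Ω) (u : ℤ → Ω → (Fin K → ℝ)) (s : ℤ) :
    Matrix (Fin K) (Fin K) ℝ :=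
  Matrix.of fun a b => covariance (fun ω => u 0 ω a) (fun ω => u s ω b) μ

/-- The conditional expectation `E(A | 𝒟)` of a random matrix, entry by entry. -/
def condMat {a b : Type*} (μ : Measure Ω) (𝒟 : MeasurableSpace Ω)
    (A : Ω → Matrix a b ℝ) (ω : Ω) : Matrix a b ℝ :=
  Matrix.of fun i j => (μ[fun ω' => A ω' i j | 𝒟]) ω

end Processes

/-! ### The model

Units are `i = 0, 1, 2, …`, a sample of size `(N, T)` consists of the units `i < N` and the
times `t = 1, …, T`. -/

/-- The ingredients of the heterogeneous threshold model
`y_it = β_i' x_it + δ_i' w_it 1{q_it ≤ γ_i} + e_it`, `w_it = R' x_it`,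
`x_it = Π_i' f_t + ξ_it`, `e_it = λ_i' f_t + ε_it`. -/
structure Model (Ω : Type*) (m K r : ℕ) where
  /-- common factors -/
  f : ℤ → Ω → (Fin m → ℝ)
  /-- idiosyncratic parts of the regressors -/
  ξ : ℕ → ℤ → Ω → (Fin K → ℝ)
  /-- idiosyncratic errors -/
  ε : ℕ → ℤ → Ω → ℝ
  /-- threshold variables -/
  q : ℕ → ℤ → Ω → ℝ
  /-- factor loadings of the regressors -/
  Pi : ℕ → Matrix (Fin m) (Fin K) ℝ
  /-- factor loadings of the errors -/
  lam : ℕ → (Fin m → ℝ)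
  /-- the matrix selecting the regressors whose coefficients switch; the identity in the pure
  threshold model -/
  R : Matrix (Fin K) (Fin r) ℝ
  /-- true slopes -/
  β : ℕ → (Fin K → ℝ)
  /-- true threshold effects -/
  δ : ℕ → (Fin r → ℝ)
  /-- true thresholds -/
  γ : ℕ → ℝ
  /-- lower ends of the threshold parameter spaces -/
  lo : ℕ → ℝ
  /-- upper ends of the threshold parameter spaces -/
  hi : ℕ → ℝ

namespace Model

variable {Ω : Type*} {m K r : ℕ} (D : Model Ω m K r)

/-- The time `1, …, T` of the row with index `0, …, T - 1`. -/
def time {T : ℕ} (s : Fin T) : ℤ := (s : ℤ) + 1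

/-- The parameter space `Γ_i` of the threshold of unit `i`. -/
def Γ (i : ℕ) : Set ℝ := Set.Icc (D.lo i) (D.hi i)

/-- The regressors `x_it = Π_i' f_t + ξ_it`. -/
def x (i : ℕ) (t : ℤ) (ω : Ω) : Fin K → ℝ := (D.Pi i)ᵀ *ᵥ D.f t ω + D.ξ i t ω

/-- The regressors `w_it(γ) = R' x_it 1{q_it ≤ γ}`. -/
def w (i : ℕ) (γ : ℝ) (t : ℤ) (ω : Ω) : Fin r → ℝ :=
  if D.q i t ω ≤ γ then D.Rᵀ *ᵥ D.x i t ω else 0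

/-- The composite errors `e_it = λ_i' f_t + ε_it`. -/
def e (i : ℕ) (t : ℤ) (ω : Ω) : ℝ := D.lam i ⬝ᵥ D.f t ω + D.ε i t ω

/-- The dependent variable. -/
def y (i : ℕ) (t : ℤ) (ω : Ω) : ℝ :=
  D.β i ⬝ᵥ D.x i t ω + D.δ i ⬝ᵥ D.w i (D.γ i) t ω + D.e i t ω

/-- `F`, the `T × m` matrix of factors. -/
def Fmat (T : ℕ) (ω : Ω) : Matrix (Fin T) (Fin m) ℝ := Matrix.of fun s => D.f (time s) ω

/-- `X_i`, the `T × K` matrix of regressors. -/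
def Xmat (i T : ℕ) (ω : Ω) : Matrix (Fin T) (Fin K) ℝ := Matrix.of fun s => D.x i (time s) ω

/-- `W_i(γ)`, the `T × r` matrix of threshold regressors. -/
def Wmat (i T : ℕ) (γ : ℝ) (ω : Ω) : Matrix (Fin T) (Fin r) ℝ :=
  Matrix.of fun s => D.w i γ (time s) ω

/-- `y_i`, the `T`-vector of observations of the dependent variable. -/
def yvec (i T : ℕ) (ω : Ω) : Fin T → ℝ := fun s => D.y i (time s) ω

/-- The cross-sectional average of the regressors. -/
def Xbar (N T : ℕ) (ω : Ω) : Matrix (Fin T) (Fin K) ℝ :=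
  (N : ℝ)⁻¹ • ∑ j ∈ Finset.range N, D.Xmat j T ω

/-- The cross-sectional average of the loadings of the regressors. -/
def Pibar (N : ℕ) : Matrix (Fin m) (Fin K) ℝ :=
  (N : ℝ)⁻¹ • ∑ j ∈ Finset.range N, D.Pi j

/-! Quantities with a tilde are premultiplied by the projection off the averages. -/

/-- The tilde version of `y_i`. -/
def yTilde (i N T : ℕ) (ω : Ω) : Fin T → ℝ := annihilator (D.Xbar N T ω) *ᵥ D.yvec i T ω

/-- The tilde version of `W_i(γ)`. -/
def WTilde (i N T : ℕ) (γ : ℝ) (ω : Ω) : Matrix (Fin T) (Fin r) ℝ :=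
  annihilator (D.Xbar N T ω) * D.Wmat i T γ ω

/-- The tilde version of `Z_i(γ) = (X_i, W_i(γ))`. -/
def ZTilde (i N T : ℕ) (γ : ℝ) (ω : Ω) : Matrix (Fin T) (Fin K ⊕ Fin r) ℝ :=
  Matrix.fromCols (annihilator (D.Xbar N T ω) * D.Xmat i T ω) (D.WTilde i N T γ ω)

/-- The estimator of the slopes `(β_i, δ_i)` for a given threshold `γ`. -/
def thetaHat (i N T : ℕ) (γ : ℝ) (ω : Ω) : Fin K ⊕ Fin r → ℝ :=
  ((D.ZTilde i N T γ ω)ᵀ * D.ZTilde i N T γ ω)⁻¹ *ᵥ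
    ((D.ZTilde i N T γ ω)ᵀ *ᵥ D.yTilde i N T ω)

/-- The sum of squared residuals of unit `i` at the threshold `γ`. -/
def ssr (i N T : ℕ) (γ : ℝ) (ω : Ω) : ℝ :=
  (D.yTilde i N T ω - D.ZTilde i N T γ ω *ᵥ D.thetaHat i N T γ ω) ⬝ᵥ
    (D.yTilde i N T ω - D.ZTilde i N T γ ω *ᵥ D.thetaHat i N T γ ω)

/-- `g` minimises the sum of squared residuals of unit `i` over `Γ_i`. -/
def IsThresholdEstimate (i N T : ℕ) (ω : Ω) (g : ℝ) : Prop :=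
  g ∈ D.Γ i ∧ ∀ γ ∈ D.Γ i, D.ssr i N T g ω ≤ D.ssr i N T γ ω

/-- `S_1i(γ)`. -/
def S1 (i N T : ℕ) (γ : ℝ) (ω : Ω) : Matrix (Fin K ⊕ Fin r) (Fin K ⊕ Fin r) ℝ :=
  (D.ZTilde i N T γ ω)ᵀ * D.ZTilde i N T γ ω

/-- `S_2i(γ)`. -/
def S2 (i N T : ℕ) (γ : ℝ) (ω : Ω) : Matrix (Fin K ⊕ Fin r) (Fin r) ℝ :=
  (D.ZTilde i N T γ ω)ᵀ * (D.WTilde i N T (D.γ i) ω - D.WTilde i N T γ ω)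

/-- `S_3i(γ)`. -/
def S3 (i N T : ℕ) (γ : ℝ) (ω : Ω) : Matrix (Fin r) (Fin r) ℝ :=
  (D.WTilde i N T (D.γ i) ω - D.WTilde i N T γ ω)ᵀ *
    (D.WTilde i N T (D.γ i) ω - D.WTilde i N T γ ω)

/-- The sigma-field `𝒟 = σ(F)` generated by the factors of the sample. -/
abbrev facSigma (T : ℕ) : MeasurableSpace Ω :=
  ⨆ s : Fin T, MeasurableSpace.comap (D.f (time s)) inferInstance

/-- `E_𝒟(T⁻¹ X_i' M_F X_i)`. -/
def MXX [MeasurableSpace Ω] (μ : Measure Ω) (i T : ℕ) : Ω → Matrix (Fin K) (Fin K) ℝ :=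
  condMat μ (D.facSigma T) fun ω =>
    (T : ℝ)⁻¹ • ((D.Xmat i T ω)ᵀ * annihilator (D.Fmat T ω) * D.Xmat i T ω)

/-- `E_𝒟(T⁻¹ X_i' M_F W_i(γ))`. -/
def MXW [MeasurableSpace Ω] (μ : Measure Ω) (i T : ℕ) (γ : ℝ) : Ω → Matrix (Fin K) (Fin r) ℝ :=
  condMat μ (D.facSigma T) fun ω =>
    (T : ℝ)⁻¹ • ((D.Xmat i T ω)ᵀ * annihilator (D.Fmat T ω) * D.Wmat i T γ ω)

/-- `E_𝒟(T⁻¹ W_i(γ)' M_F W_i(γ))`. -/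
def MWW [MeasurableSpace Ω] (μ : Measure Ω) (i T : ℕ) (γ : ℝ) : Ω → Matrix (Fin r) (Fin r) ℝ :=
  condMat μ (D.facSigma T) fun ω =>
    (T : ℝ)⁻¹ • ((D.Wmat i T γ ω)ᵀ * annihilator (D.Fmat T ω) * D.Wmat i T γ ω)

end Model

/-! ### Assumptions -/

section Assumptions

variable {Ω : Type*} [MeasurableSpace Ω] {m K r : ℕ}

/-- All primitive processes are random variables. -/
structure MeasurableData (D : Model Ω m K r) : Prop where
  f : ∀ t, Measurable (D.f t)
  ξ : ∀ i t, Measurable (D.ξ i t)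
  ε : ∀ i t, Measurable (D.ε i t)
  q : ∀ i t, Measurable (D.q i t)

/-- Common factors. -/
structure CommonFactors (μ : Measure Ω) (D : Model Ω m K r) : Prop where
  stationary : StationaryErgodic μ D.f
  indep_error : IndepFun (fun ω t => D.f t ω) (fun ω i t => D.ε i t ω) μ
  indep_regressor : IndepFun (fun ω t => D.f t ω) (fun ω i t => D.ξ i t ω) μ
  moment : ∃ κ : ℝ, 0 < κ ∧ ∀ t, MemLp (D.f t) (ENNReal.ofReal (4 + κ)) μ
  lln : ∃ Sf : Matrix (Fin m) (Fin m) ℝ, Sf.PosDef ∧ ∀ a b,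
    TendstoInMeasure μ
      (fun (T : ℕ) ω => ((T : ℝ)⁻¹ • ((D.Fmat T ω)ᵀ * D.Fmat T ω)) a b) atTop (fun _ => Sf a b)

/-- Fixed factor loadings. The averaged loadings have rank `m` for every `N` and in the limit:
every limit point of them, as `N → ∞`, has rank `m` as well. (The choice of the norm on `ℝ^m` is
immaterial for boundedness.) -/
structure FactorLoadings (D : Model Ω m K r) : Prop where
  rank : ∀ N, 1 ≤ N → (D.Pibar N).rank = m
  rank_limit : ∀ P, MapClusterPt P atTop D.Pibar → P.rank = m
  le : m ≤ K
  bdd_Pi : ∃ C, ∀ i, frobNorm (D.Pi i) ≤ C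
  bdd_lam : ∃ C, ∀ i, ‖D.lam i‖ ≤ C

/-- Regressors. -/
structure Regressors (μ : Measure Ω) (D : Model Ω m K r) : Prop where
  indep : iIndepFun (fun i ω t => D.ξ i t ω) μ
  stationary : ∀ i, StationaryErgodic μ (D.ξ i)
  mixing : ∀ i, Summable fun n : ℕ => Real.sqrt (rhoMix μ (D.ξ i) (n + 1))
  cond_mean : ∀ N i t, i < N → ∀ a,
    μ[fun ω => D.ξ i t ω a |
      ⨆ j : Fin N, MeasurableSpace.comap (D.ξ j (t - 1)) inferInstance] =ᵐ[μ] 0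
  moment : ∃ κ : ℝ, 0 < κ ∧ ∀ i t, MemLp (D.ξ i t) (ENNReal.ofReal (4 + κ)) μ
  cov_nonsingular : ∀ i, (autocov μ (D.ξ i) 0).det ≠ 0
  cov_bdd : ∃ C, ∀ i, frobNorm (autocov μ (D.ξ i) 0) ≤ C
  cumulant_bdd : ∃ C, ∀ i (a b c d : Fin K) (t₁ t₂ t₃ t₄ : ℤ),
    |cumulant4 μ (fun ω => D.ξ i t₁ ω a) (fun ω => D.ξ i t₂ ω b)
      (fun ω => D.ξ i t₃ ω c) (fun ω => D.ξ i t₄ ω d)| ≤ C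
  autocov_bdd : ∃ C, ∀ i, Summable (fun s : ℤ => frobNorm (autocov μ (D.ξ i) s)) ∧
    ∑' s : ℤ, frobNorm (autocov μ (D.ξ i) s) ≤ C

/-- Errors. -/
structure Errors (μ : Measure Ω) (D : Model Ω m K r) : Prop where
  indep : iIndepFun (fun i ω t => D.ε i t ω) μ
  stationary : ∀ i, StationaryErgodic μ (D.ε i)
  mixing : ∀ i, Summable fun n : ℕ => Real.sqrt (rhoMix μ (D.ε i) (n + 1))
  cond_mean : ∀ N i t, i < N →
    μ[D.ε i t | ⨆ j : Fin N, MeasurableSpace.comap (D.ε j (t - 1)) inferInstance] =ᵐ[μ] 0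
  moment : ∃ κ : ℝ, 0 < κ ∧ ∀ i t, MemLp (D.ε i t) (ENNReal.ofReal (4 + κ)) μ
  var_pos : ∀ i, 0 < variance (D.ε i 0) μ
  var_bdd : ∃ C, ∀ i, variance (D.ε i 0) μ ≤ C
  cumulant_bdd : ∃ C, ∀ i (t₁ t₂ t₃ t₄ : ℤ),
    |cumulant4 μ (D.ε i t₁) (D.ε i t₂) (D.ε i t₃) (D.ε i t₄)| ≤ C
  autocov_bdd : ∃ C, ∀ i, Summable (fun s : ℤ => |covariance (D.ε i 0) (D.ε i s) μ|) ∧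
    ∑' s : ℤ, |covariance (D.ε i 0) (D.ε i s) μ| ≤ C
  indep_regressor : IndepFun (fun ω i t => D.ε i t ω) (fun ω i t => D.ξ i t ω) μ

/-- The threshold variables are exogenous: together with the factors and the regressors they are
independent of the idiosyncratic error of the unit. -/
def ExogenousThreshold (μ : Measure Ω) (D : Model Ω m K r) : Prop :=
  ∀ i, IndepFun
    (fun ω => ((fun t => D.f t ω), (fun j t => D.ξ j t ω), (fun t => D.q i t ω)))
    (fun ω t => D.ε i t ω) μ

/-- Continuous threshold variable: given the factors, `q_it` has a conditional density `p`,
continuous at the true threshold, and uniformly bounded on `Γ_i`. -/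
def ContinuousThreshold (μ : Measure Ω) (D : Model Ω m K r) : Prop :=
  ∃ (p : ∀ T : ℕ, ℕ → Fin T → Ω → ℝ → ℝ) (C : ℝ), ∀ T i (s : Fin T),
    Measurable[(D.facSigma T).prod inferInstance] (fun z : Ω × ℝ => p T i s z.1 z.2) ∧
    (∀ ω u, 0 ≤ p T i s ω u) ∧
    (∀ B : Set ℝ, MeasurableSet B →
      μ[(D.q i (Model.time s) ⁻¹' B).indicator (fun _ => (1 : ℝ)) | D.facSigma T]
        =ᵐ[μ] fun ω => ∫ u in B, p T i s ω u) ∧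
    (∀ᵐ ω ∂μ, ContinuousAt (p T i s ω) (D.γ i)) ∧
    (∀ᵐ ω ∂μ, ∀ u ∈ D.Γ i, p T i s ω u ≤ C)

/-- Identification. The eigenvalue bound holds, with probability tending to one, simultaneously
at all thresholds outside any fixed neighbourhood of the true one. -/
structure Identification (μ : Measure Ω) (D : Model Ω m K r) : Prop where
  delta_ne : ∀ i, D.δ i ≠ 0
  bound : ∀ i, ∃ τ : ℝ, 0 < τ ∧ ∀ η : ℝ, 0 < η →
    Tendsto (fun n : ℕ × ℕ => μ {ω | ¬ ∀ γ ∈ D.Γ i, η ≤ |γ - D.γ i| →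
      τ * min 1 |γ - D.γ i| ≤
        lmin ((n.2 : ℝ)⁻¹ • (D.S3 i n.1 n.2 γ ω -
          (D.S2 i n.1 n.2 γ ω)ᵀ * (D.S1 i n.1 n.2 γ ω)⁻¹ * D.S2 i n.1 n.2 γ ω))})
      atTop (𝓝 0)

/-- Threshold parameter space: `γ_i⁰ ∈ Γ_i`, a compact interval. -/
def ThresholdSpace (D : Model Ω m K r) : Prop := ∀ i, D.γ i ∈ D.Γ i

/-- Full rank conditions. -/
structure FullRank (μ : Measure Ω) (D : Model Ω m K r) : Prop where
  population : ∀ i, ∀ γ ∈ D.Γ i, ∀ᶠ T : ℕ in atTop, ∀ᵐ ω ∂μ,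
    (Matrix.fromBlocks (D.MXX μ i T ω) (D.MXW μ i T γ ω)
      (D.MXW μ i T γ ω)ᵀ (D.MWW μ i T γ ω)).PosDef
  sample : ∀ i, Tendsto (fun n : ℕ × ℕ =>
    μ {ω | ¬ ∀ γ ∈ D.Γ i, (D.S1 i n.1 n.2 γ ω).PosDef}) atTop (𝓝 0)

/-- Uniformly bounded moments. The first three bounds are conditional on the factors,
so they may depend on the realisation of the latter. -/
structure BoundedMoments (μ : Measure Ω) (D : Model Ω m K r) : Prop where
  xx : ∃ C : Ω → ℝ, ∀ (T i : ℕ), 1 ≤ T → ∀ᵐ ω ∂μ, frobNorm (D.MXX μ i T ω) ^ 2 ≤ C ω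
  xw : ∃ C : Ω → ℝ, ∀ (T i : ℕ), 1 ≤ T → ∀ γ ∈ D.Γ i, ∀ᵐ ω ∂μ, frobNorm (D.MXW μ i T γ ω) ^ 2 ≤ C ω
  ww : ∃ C : Ω → ℝ, ∀ (T i : ℕ), 1 ≤ T → ∀ γ ∈ D.Γ i, ∀ᵐ ω ∂μ, frobNorm (D.MWW μ i T γ ω) ^ 2 ≤ C ω
  unconditional : ∃ C : ℝ, ∀ (T i : ℕ), 1 ≤ T → ∀ γ ∈ D.Γ i,
    frobNorm (Matrix.of fun a b =>
      ∫ ω, ((T : ℝ)⁻¹ • ((D.Wmat i T γ ω)ᵀ * D.Wmat i T γ ω)) a b ∂μ) ^ 2 ≤ C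

end Assumptions

end PanelThreshold

end

/-!
The sum of squared residuals of the unit is compared at the true threshold `γ⁰` and at a threshold
`γ` with `|γ - γ⁰| ≥ η`. Write `M` for the projection off the averages `X̄`, `φ = Fλ` for the factor
part of the error and `ε` for its idiosyncratic part. At `γ⁰` the sum of squared residuals is at
most `‖M(φ + ε)‖²`, since the true slopes compete in the least squares problem. At `γ` it equals
`‖v + M(φ + ε)‖²`, where `v = M v` lies in the span of `X̄, X, W(γ⁰), W(γ)`, and `‖v‖²` is at least
the Schur complement form at `δ`, which by identification is at least a constant times `T`. Hence
`γ` cannot be a minimiser once `⟨v, Mφ⟩² ≤ k T ‖v‖²` and `⟨v, ε⟩² ≤ k T ‖v‖²` for a small constant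
`k` (`Model.ssr_lt_ssr`). It remains to see that both hold, uniformly in `γ`, with probability
tending to one.

*Factor part* (`tendsto_factor_part`). By the rank condition in the limit and compactness,
`λ = Π̄ g` with `g` bounded in `N`. As `X̄ = FΠ̄ + ξ̄`, the vector `MFλ = -Mξ̄g` is no longer than
`ξ̄g`, whose mean square is of order `T / N` because the `ξ_j` are independent and centred.

*Idiosyncratic part* (`tendsto_error_part`). No lower bound on `Z̃(γ)'Z̃(γ) / T`, uniform in `γ`, is
available, so the projections of `ε` on the column spaces are bounded directly. By exogeneity the
design is independent of `ε` and may be held fixed. Order the times by the threshold variable and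
cut them into about `√T` cells of about `√T` times each. As `γ` varies inside a cell, the indicator
of `q ≤ γ` is constant outside that cell, so the projection of `ε` is bounded by its projection on
one fixed space of bounded dimension plus the norm of `ε` on the cell
(`measure_exceptionalSet_le_cells`). The former is controlled by the summable autocovariances, the
latter by fourth moments, and the union bound over the cells costs a factor `√T` against
probabilities of order `1 / T`.
-/

noncomputable section

namespace PanelThreshold

/-! ### Projections and least squares -/

section Annihilator

variable {a b : Type*} [Fintype a] [DecidableEq a] [Fintype b] [DecidableEq b]

lemma annihilator_mulVec (A : Matrix a b ℝ) (v : a → ℝ) :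
    annihilator A *ᵥ v =
      ((LinearMap.range (Matrix.toEuclideanLin A))ᗮ.starProjection (WithLp.toLp 2 v)).ofLp := by
  have h : Matrix.toEuclideanLin (annihilator A) (WithLp.toLp 2 v) =
      (LinearMap.range (Matrix.toEuclideanLin A))ᗮ.starProjection (WithLp.toLp 2 v) := by
    rw [annihilator, LinearEquiv.apply_symm_apply]; rfl
  rw [← h]
  simp [Matrix.toLpLin_apply]

lemma annihilator_dotProduct (A : Matrix a b ℝ) (v w : a → ℝ) :
    (annihilator A *ᵥ v) ⬝ᵥ w = v ⬝ᵥ (annihilator A *ᵥ w) := by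
  have h := Submodule.inner_starProjection_left_eq_right
    (LinearMap.range (Matrix.toEuclideanLin A))ᗮ (WithLp.toLp 2 w) (WithLp.toLp 2 v)
  rw [annihilator_mulVec, annihilator_mulVec]
  simp only [EuclideanSpace.inner_eq_star_dotProduct, star_trivial] at h
  exact h.symm

lemma annihilator_mulVec_idem (A : Matrix a b ℝ) (v : a → ℝ) :
    annihilator A *ᵥ (annihilator A *ᵥ v) = annihilator A *ᵥ v := by
  simp only [annihilator_mulVec, WithLp.toLp_ofLp]
  congr 1
  exact Submodule.starProjection_eq_self_iff.2 (Submodule.starProjection_apply_mem _ _)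

lemma annihilator_mulVec_self (A : Matrix a b ℝ) (c : b → ℝ) :
    annihilator A *ᵥ (A *ᵥ c) = 0 := by
  rw [annihilator_mulVec]
  have h : WithLp.toLp 2 (A *ᵥ c) ∈ (LinearMap.range (Matrix.toEuclideanLin A))ᗮᗮ :=
    Submodule.le_orthogonal_orthogonal _ ⟨WithLp.toLp 2 c, by simp [Matrix.toLpLin_apply]⟩
  rw [(Submodule.starProjection_apply_eq_zero_iff _).2 h]
  rfl

lemma exists_annihilator_mulVec_eq (A : Matrix a b ℝ) (v : a → ℝ) :
    ∃ c, annihilator A *ᵥ v = v - A *ᵥ c := by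
  set U := LinearMap.range (Matrix.toEuclideanLin A)
  have h := U.starProjection_add_starProjection_orthogonal (WithLp.toLp 2 v)
  obtain ⟨c, hc⟩ : U.starProjection (WithLp.toLp 2 v) ∈ U := Submodule.starProjection_apply_mem _ _
  refine ⟨c.ofLp, ?_⟩
  rw [annihilator_mulVec, eq_sub_iff_add_eq']
  rw [← hc] at h
  simpa [Matrix.toLpLin_apply] using congrArg WithLp.ofLp h

lemma annihilator_sq_le (A : Matrix a b ℝ) (v : a → ℝ) :
    (annihilator A *ᵥ v) ⬝ᵥ (annihilator A *ᵥ v) ≤ v ⬝ᵥ v := by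
  have h1 : (annihilator A *ᵥ v) ⬝ᵥ (annihilator A *ᵥ v) = v ⬝ᵥ (annihilator A *ᵥ v) := by
    rw [annihilator_dotProduct, annihilator_mulVec_idem]
  have h2 : 0 ≤ (v - annihilator A *ᵥ v) ⬝ᵥ (v - annihilator A *ᵥ v) := by
    simpa using dotProduct_star_self_nonneg (v - annihilator A *ᵥ v)
  rw [sub_dotProduct, dotProduct_sub, dotProduct_sub, h1, annihilator_dotProduct] at h2
  linarith

end Annihilator

section LeastSquares

variable {a b c : Type*} [Fintype a] [Fintype b] [DecidableEq b] [Fintype c]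

lemma dotProduct_self_nonneg_real (v : a → ℝ) : 0 ≤ v ⬝ᵥ v := by
  simpa using dotProduct_star_self_nonneg v

lemma dotProduct_sq_le (v w : a → ℝ) : (v ⬝ᵥ w) ^ 2 ≤ (v ⬝ᵥ v) * (w ⬝ᵥ w) := by
  simpa [dotProduct, sq] using Finset.sum_mul_sq_le_sq_mul_sq Finset.univ v w

lemma sq_sub_mulVec_eq (Z : Matrix a b ℝ) (h : IsUnit (Zᵀ * Z).det) (y : a → ℝ) (θ : b → ℝ) :
    (y - Z *ᵥ θ) ⬝ᵥ (y - Z *ᵥ θ) =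
      (y - Z *ᵥ ((Zᵀ * Z)⁻¹ *ᵥ (Zᵀ *ᵥ y))) ⬝ᵥ (y - Z *ᵥ ((Zᵀ * Z)⁻¹ *ᵥ (Zᵀ *ᵥ y))) +
      (Z *ᵥ ((Zᵀ * Z)⁻¹ *ᵥ (Zᵀ *ᵥ y) - θ)) ⬝ᵥ (Z *ᵥ ((Zᵀ * Z)⁻¹ *ᵥ (Zᵀ *ᵥ y) - θ)) := by
  set p := (Zᵀ * Z)⁻¹ *ᵥ (Zᵀ *ᵥ y) with hp
  have hort : ∀ η, (y - Z *ᵥ p) ⬝ᵥ (Z *ᵥ η) = 0 := by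
    intro η
    rw [dotProduct_mulVec, ← mulVec_transpose, mulVec_sub, mulVec_mulVec, hp, mulVec_mulVec,
      Matrix.mul_nonsing_inv _ h, one_mulVec, sub_self, zero_dotProduct]
  have e : y - Z *ᵥ θ = (y - Z *ᵥ p) + Z *ᵥ (p - θ) := by rw [mulVec_sub]; abel
  rw [e, add_dotProduct, dotProduct_add, dotProduct_add, hort, dotProduct_comm (Z *ᵥ (p - θ)), hort]
  ring

lemma leastSquares_le (Z : Matrix a b ℝ) (h : IsUnit (Zᵀ * Z).det) (y : a → ℝ) (θ : b → ℝ) :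
    (y - Z *ᵥ ((Zᵀ * Z)⁻¹ *ᵥ (Zᵀ *ᵥ y))) ⬝ᵥ (y - Z *ᵥ ((Zᵀ * Z)⁻¹ *ᵥ (Zᵀ *ᵥ y))) ≤
      (y - Z *ᵥ θ) ⬝ᵥ (y - Z *ᵥ θ) := by
  rw [sq_sub_mulVec_eq Z h y θ]
  linarith [dotProduct_self_nonneg_real (Z *ᵥ ((Zᵀ * Z)⁻¹ *ᵥ (Zᵀ *ᵥ y) - θ))]

/-- The quadratic form of a Schur complement is the squared distance to the column space. -/
lemma schur_le_sq (Z : Matrix a b ℝ) (h : IsUnit (Zᵀ * Z).det) (W : Matrix a c ℝ)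
    (d : c → ℝ) (θ : b → ℝ) :
    d ⬝ᵥ ((Wᵀ * W - (Zᵀ * W)ᵀ * (Zᵀ * Z)⁻¹ * (Zᵀ * W)) *ᵥ d) ≤
      (W *ᵥ d - Z *ᵥ θ) ⬝ᵥ (W *ᵥ d - Z *ᵥ θ) := by
  have h0 := sq_sub_mulVec_eq Z h (W *ᵥ d) 0
  have h1 := leastSquares_le Z h (W *ᵥ d) θ
  simp only [mulVec_zero, sub_zero] at h0
  have e1 : (W *ᵥ d) ⬝ᵥ (W *ᵥ d) = d ⬝ᵥ ((Wᵀ * W) *ᵥ d) := by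
    rw [← mulVec_mulVec, dotProduct_mulVec d, vecMul_transpose]
  set p := (Zᵀ * Z)⁻¹ *ᵥ (Zᵀ *ᵥ (W *ᵥ d)) with hp
  have e2 : (Z *ᵥ p) ⬝ᵥ (Z *ᵥ p) =
      d ⬝ᵥ (((Zᵀ * W)ᵀ * (Zᵀ * Z)⁻¹ * (Zᵀ * W)) *ᵥ d) := by
    have : Zᵀ *ᵥ (Z *ᵥ p) = (Zᵀ * W) *ᵥ d := by
      rw [hp, mulVec_mulVec, mulVec_mulVec, Matrix.mul_nonsing_inv _ h, one_mulVec, mulVec_mulVec]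
    rw [dotProduct_mulVec, ← mulVec_transpose, this, hp, mulVec_mulVec d,
      Matrix.mul_assoc, ← mulVec_mulVec d (Zᵀ * W)ᵀ, dotProduct_mulVec d, vecMul_transpose,
      ← mulVec_mulVec d _ (Zᵀ * W)]
  rw [sub_mulVec, dotProduct_sub, ← e1, ← e2]
  linarith

/-- The smallest eigenvalue bounds the quadratic form from below. -/
lemma lmin_mul_le [DecidableEq c] (A : Matrix c c ℝ) (hA : Aᵀ = A) (d : c → ℝ) :
    lmin A * (d ⬝ᵥ d) ≤ d ⬝ᵥ (A *ᵥ d) := by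
  have hH : A.IsHermitian := by simpa [Matrix.IsHermitian] using hA
  have hB : (A - algebraMap ℝ _ (lmin A)).IsHermitian := by
    rw [Matrix.algebraMap_eq_diagonal]
    exact hH.sub (Matrix.isHermitian_diagonal _)
  have hps : (A - algebraMap ℝ _ (lmin A)).PosSemidef := by
    refine hB.posSemidef_iff_eigenvalues_nonneg.2 fun j => ?_
    have hj : hB.eigenvalues j ∈ spectrum ℝ (A - algebraMap ℝ _ (lmin A)) := by
      rw [hB.spectrum_real_eq_range_eigenvalues]; exact ⟨j, rfl⟩
    have h2 : hB.eigenvalues j + lmin A ∈ spectrum ℝ A := by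
      have := spectrum.add_mem_add_iff (r := hB.eigenvalues j) (s := lmin A)
        (a := A - algebraMap ℝ _ (lmin A))
      rw [← this] at hj
      simpa using hj
    have hfin : (spectrum ℝ A).Finite := by
      rw [hH.spectrum_real_eq_range_eigenvalues]; exact Set.finite_range _
    have := csInf_le hfin.bddBelow h2
    simp only [lmin, Pi.zero_apply] at this ⊢
    linarith
  have := hps.dotProduct_mulVec_nonneg d
  rw [Algebra.algebraMap_eq_smul_one, sub_mulVec, dotProduct_sub, smul_mulVec, one_mulVec,
    dotProduct_smul] at this
  simp only [star_trivial, smul_eq_mul] at this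
  linarith

end LeastSquares

namespace Model

variable {Ω : Type*} {m K r : ℕ} (D : Model Ω m K r)

lemma yvec_eq (i T : ℕ) (ω : Ω) :
    D.yvec i T ω = D.Xmat i T ω *ᵥ D.β i + D.Wmat i T (D.γ i) ω *ᵥ D.δ i +
      (D.Fmat T ω *ᵥ D.lam i + fun s => D.ε i (time s) ω) := by
  ext s
  simp [yvec, y, e, Xmat, Wmat, Fmat, mulVec, dotProduct_comm]

/-- A threshold at which the identified signal exceeds both parts of the error has a larger sum of
squared residuals than the true one. The vectors in the last hypothesis contain the part of `y` left
unexplained at `γ`, before the error is added. -/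
lemma ssr_lt_ssr (i N T : ℕ) (γ : ℝ) (ω : Ω) {κ : ℝ} (hκ : 0 < κ) (hT : 0 < T)
    (h0 : (D.S1 i N T (D.γ i) ω).PosDef) (h1 : (D.S1 i N T γ ω).PosDef)
    (hid : 16 * κ < lmin ((T : ℝ)⁻¹ • (D.S3 i N T γ ω -
          (D.S2 i N T γ ω)ᵀ * (D.S1 i N T γ ω)⁻¹ * D.S2 i N T γ ω)) * (D.δ i ⬝ᵥ D.δ i))
    (hF : (annihilator (D.Xbar N T ω) *ᵥ (D.Fmat T ω *ᵥ D.lam i)) ⬝ᵥ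
      (annihilator (D.Xbar N T ω) *ᵥ (D.Fmat T ω *ᵥ D.lam i)) ≤ κ * T)
    (hε : ∀ a b c d, ((D.Xbar N T ω *ᵥ a + D.Xmat i T ω *ᵥ b + D.Wmat i T (D.γ i) ω *ᵥ c +
        D.Wmat i T γ ω *ᵥ d) ⬝ᵥ fun s => D.ε i (time s) ω) ^ 2 ≤
      κ * T * ((D.Xbar N T ω *ᵥ a + D.Xmat i T ω *ᵥ b + D.Wmat i T (D.γ i) ω *ᵥ c +
        D.Wmat i T γ ω *ᵥ d) ⬝ᵥ (D.Xbar N T ω *ᵥ a + D.Xmat i T ω *ᵥ b +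
          D.Wmat i T (D.γ i) ω *ᵥ c + D.Wmat i T γ ω *ᵥ d))) :
    D.ssr i N T (D.γ i) ω < D.ssr i N T γ ω := by
  set A := annihilator (D.Xbar N T ω) with hA
  set ε : Fin T → ℝ := fun s => D.ε i (time s) ω
  set φ := D.Fmat T ω *ᵥ D.lam i
  have hT' : (0 : ℝ) < T := by exact_mod_cast hT
  have hu0 : IsUnit ((D.ZTilde i N T (D.γ i) ω)ᵀ * D.ZTilde i N T (D.γ i) ω).det :=
    h0.det_pos.ne'.isUnit
  have hu1 : IsUnit ((D.ZTilde i N T γ ω)ᵀ * D.ZTilde i N T γ ω).det := h1.det_pos.ne'.isUnit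
  have hZ : ∀ g θ, D.ZTilde i N T g ω *ᵥ θ =
      A *ᵥ (D.Xmat i T ω *ᵥ (θ ∘ Sum.inl)) + A *ᵥ (D.Wmat i T g ω *ᵥ (θ ∘ Sum.inr)) := by
    intro g θ
    rw [ZTilde, WTilde, fromCols_mulVec, mulVec_mulVec, mulVec_mulVec]
  have hy : D.yTilde i N T ω = A *ᵥ (D.Xmat i T ω *ᵥ D.β i) +
      A *ᵥ (D.Wmat i T (D.γ i) ω *ᵥ D.δ i) + A *ᵥ (φ + ε) := by
    rw [yTilde, yvec_eq, mulVec_add, mulVec_add]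
  have hle : D.ssr i N T (D.γ i) ω ≤ (A *ᵥ (φ + ε)) ⬝ᵥ (A *ᵥ (φ + ε)) := by
    have := leastSquares_le _ hu0 (D.yTilde i N T ω) (Sum.elim (D.β i) (D.δ i))
    have e : D.yTilde i N T ω - D.ZTilde i N T (D.γ i) ω *ᵥ (Sum.elim (D.β i) (D.δ i)) =
        A *ᵥ (φ + ε) := by
      rw [hy, hZ, Sum.elim_comp_inl, Sum.elim_comp_inr]; abel
    rw [e] at this
    exact this
  set θ := D.thetaHat i N T γ ω with hθ
  set v := A *ᵥ (D.Xmat i T ω *ᵥ (D.β i - θ ∘ Sum.inl) + D.Wmat i T (D.γ i) ω *ᵥ D.δ i +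
    D.Wmat i T γ ω *ᵥ (- (θ ∘ Sum.inr))) with hv
  have hssr : D.ssr i N T γ ω = (v + A *ᵥ (φ + ε)) ⬝ᵥ (v + A *ᵥ (φ + ε)) := by
    have e : D.yTilde i N T ω - D.ZTilde i N T γ ω *ᵥ θ = v + A *ᵥ (φ + ε) := by
      rw [hy, hZ, hv]
      simp only [mulVec_add, mulVec_sub, mulVec_neg]
      abel
    rw [ssr, ← hθ, e]
  have hvS : 16 * κ * T < v ⬝ᵥ v := by
    have h2 := schur_le_sq (D.ZTilde i N T γ ω) hu1
      (D.WTilde i N T (D.γ i) ω - D.WTilde i N T γ ω) (D.δ i)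
      (Sum.elim (θ ∘ Sum.inl - D.β i) (θ ∘ Sum.inr - D.δ i))
    have e : (D.WTilde i N T (D.γ i) ω - D.WTilde i N T γ ω) *ᵥ D.δ i -
        D.ZTilde i N T γ ω *ᵥ (Sum.elim (θ ∘ Sum.inl - D.β i) (θ ∘ Sum.inr - D.δ i)) = v := by
      rw [hZ, Sum.elim_comp_inl, Sum.elim_comp_inr, hv, WTilde, WTilde, sub_mulVec,
        ← mulVec_mulVec, ← mulVec_mulVec]
      simp only [mulVec_add, mulVec_sub, mulVec_neg]
      abel
    rw [e] at h2
    have h3 := lmin_mul_le ((T : ℝ)⁻¹ • (D.S3 i N T γ ω -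
          (D.S2 i N T γ ω)ᵀ * (D.S1 i N T γ ω)⁻¹ * D.S2 i N T γ ω)) (by
        have hs : (D.S1 i N T γ ω)⁻¹ᵀ = (D.S1 i N T γ ω)⁻¹ := by
          rw [S1, transpose_nonsing_inv, transpose_mul, transpose_transpose]
        have hs3 : (D.S3 i N T γ ω)ᵀ = D.S3 i N T γ ω := by
          rw [S3, transpose_mul, transpose_transpose]
        rw [transpose_smul, transpose_sub, transpose_mul, transpose_mul, transpose_transpose, hs,
          hs3, Matrix.mul_assoc]) (D.δ i)
    rw [smul_mulVec, dotProduct_smul, smul_eq_mul] at h3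
    have h4 := (hid.trans_le h3).trans_le (mul_le_mul_of_nonneg_left h2 (inv_nonneg.2 hT'.le))
    rw [inv_mul_eq_div, lt_div_iff₀ hT'] at h4
    exact h4
  have hAv : A *ᵥ v = v := annihilator_mulVec_idem _ _
  have hvε : (v ⬝ᵥ ε) ^ 2 ≤ κ * T * (v ⬝ᵥ v) := by
    obtain ⟨c, hc⟩ := exists_annihilator_mulVec_eq (D.Xbar N T ω)
      (D.Xmat i T ω *ᵥ (D.β i - θ ∘ Sum.inl) + D.Wmat i T (D.γ i) ω *ᵥ D.δ i +
        D.Wmat i T γ ω *ᵥ (- (θ ∘ Sum.inr)))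
    have := hε (-c) (D.β i - θ ∘ Sum.inl) (D.δ i) (- (θ ∘ Sum.inr))
    have e : D.Xbar N T ω *ᵥ (-c) + D.Xmat i T ω *ᵥ (D.β i - θ ∘ Sum.inl) +
        D.Wmat i T (D.γ i) ω *ᵥ D.δ i + D.Wmat i T γ ω *ᵥ (- (θ ∘ Sum.inr)) = v := by
      rw [hv, hA, hc, mulVec_neg c]; abel
    rwa [e] at this
  have hvφ : (v ⬝ᵥ (A *ᵥ φ)) ^ 2 ≤ κ * T * (v ⬝ᵥ v) := by
    refine (dotProduct_sq_le _ _).trans ?_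
    rw [mul_comm]
    exact mul_le_mul_of_nonneg_right hF (dotProduct_self_nonneg_real v)
  -- `M` moves from `ε` to `v`, which it fixes
  have hcross : v ⬝ᵥ (A *ᵥ (φ + ε)) = v ⬝ᵥ (A *ᵥ φ) + v ⬝ᵥ ε := by
    rw [mulVec_add, dotProduct_add, ← annihilator_dotProduct _ v ε, ← hA, hAv]
  have hpos : 0 < v ⬝ᵥ v := lt_of_le_of_lt (by positivity) hvS
  have hsq : (2 * (v ⬝ᵥ (A *ᵥ (φ + ε)))) ^ 2 < (v ⬝ᵥ v) ^ 2 := by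
    rw [hcross]
    have := mul_lt_mul_of_pos_right hvS hpos
    nlinarith [sq_nonneg (v ⬝ᵥ (A *ᵥ φ) - v ⬝ᵥ ε)]
  have habs := (abs_lt.1 (abs_lt_of_sq_lt_sq hsq hpos.le)).1
  rw [hssr, add_dotProduct, dotProduct_add, dotProduct_add, dotProduct_comm (A *ᵥ (φ + ε)) v]
  linarith

end Model

/-! ### Stationary processes and centred variables -/

section Stationarity

variable {Ω E : Type*} [MeasurableSpace Ω] [MeasurableSpace E] {μ : Measure Ω} {u : ℤ → Ω → E}

lemma StationaryErgodic.map_pair_succ (h : StationaryErgodic μ u) (hu : ∀ t, Measurable (u t))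
    (s t : ℤ) :
    μ.map (fun ω => (u (s + 1) ω, u (t + 1) ω)) = μ.map (fun ω => (u s ω, u t ω)) := by
  have hp : Measurable (fun ω t => u t ω) := measurable_pi_lambda _ hu
  have hm := h.toMeasurePreserving
  have he : Measurable (fun x : ℤ → E => (x s, x t)) := by fun_prop
  have := congrArg (Measure.map (fun x : ℤ → E => (x s, x t))) hm.map_eq
  rw [Measure.map_map he hm.measurable, Measure.map_map (he.comp hm.measurable) hp,
    Measure.map_map he hp] at this
  exact this

/-- The law of a pair depends on the lag only, also for negative lags. -/
lemma StationaryErgodic.map_pair (h : StationaryErgodic μ u) (hu : ∀ t, Measurable (u t))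
    (s t : ℤ) :
    μ.map (fun ω => (u s ω, u t ω)) = μ.map (fun ω => (u 0 ω, u (t - s) ω)) := by
  have key : ∀ k : ℤ, μ.map (fun ω => (u k ω, u (t - s + k) ω)) =
      μ.map (fun ω => (u 0 ω, u (t - s) ω)) := by
    intro k
    induction k using Int.induction_on with
    | zero => simp
    | succ k ih => rw [← ih, ← h.map_pair_succ hu k, add_assoc (t - s)]
    | pred k ih =>
      rw [← ih, ← h.map_pair_succ hu (-k - 1), add_assoc (t - s), sub_add_cancel]
  simpa using key s

lemma StationaryErgodic.map_eq (h : StationaryErgodic μ u) (hu : ∀ t, Measurable (u t)) (t : ℤ) :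
    μ.map (u t) = μ.map (u 0) := by
  have := congrArg (Measure.map Prod.fst) (h.map_pair hu t t)
  rw [Measure.map_map measurable_fst ((hu _).prodMk (hu _)),
    Measure.map_map measurable_fst ((hu _).prodMk (hu _))] at this
  exact this

lemma StationaryErgodic.covariance_eq (h : StationaryErgodic μ u) (hu : ∀ t, Measurable (u t))
    {g g' : E → ℝ} (hg : Measurable g) (hg' : Measurable g') (s t : ℤ) :
    covariance (fun ω => g (u s ω)) (fun ω => g' (u t ω)) μ =
      covariance (fun ω => g (u 0 ω)) (fun ω => g' (u (t - s) ω)) μ := by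
  have e : ∀ s t : ℤ, covariance (fun ω => g (u s ω)) (fun ω => g' (u t ω)) μ =
      covariance (fun p : E × E => g p.1) (fun p => g' p.2)
        (μ.map (fun ω => (u s ω, u t ω))) := by
    intro s t
    exact (covariance_map (hg.comp measurable_fst).aestronglyMeasurable
      (hg'.comp measurable_snd).aestronglyMeasurable ((hu s).prodMk (hu t)).aemeasurable).symm
  rw [e, e, h.map_pair hu]

end Stationarity

section Moments

variable {Ω : Type*} {mΩ : MeasurableSpace Ω} {μ : Measure Ω}

lemma integral_eq_zero_of_condExp_ae_eq_zero [IsFiniteMeasure μ] {𝓕 : MeasurableSpace Ω}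
    (h𝓕 : 𝓕 ≤ mΩ) {X : Ω → ℝ} (h : μ[X | 𝓕] =ᵐ[μ] 0) :
    ∫ ω, X ω ∂μ = 0 := by
  rw [← integral_condExp h𝓕 (f := X), integral_congr_ae h]
  simp

lemma lintegral_ofReal_sq [IsFiniteMeasure μ] {X : Ω → ℝ} (hX : MemLp X 2 μ)
    (h0 : ∫ ω, X ω ∂μ = 0) :
    ∫⁻ ω, ENNReal.ofReal (X ω ^ 2) ∂μ = ENNReal.ofReal (variance X μ) := by
  rw [variance_of_integral_eq_zero hX.aemeasurable h0,
    ofReal_integral_eq_lintegral_ofReal hX.integrable_sq (ae_of_all _ fun _ => sq_nonneg _)]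

end Moments

/-! ### The factor part of the error -/

section Loadings

lemma abs_le_frobNorm {a b : Type*} [Fintype a] [Fintype b] (A : Matrix a b ℝ) (i : a) (j : b) :
    |A i j| ≤ frobNorm A := by
  refine Real.abs_le_sqrt ?_
  calc A i j ^ 2 ≤ ∑ j, A i j ^ 2 :=
        Finset.single_le_sum (f := fun j => A i j ^ 2) (fun _ _ => sq_nonneg _) (Finset.mem_univ j)
    _ ≤ ∑ i, ∑ j, A i j ^ 2 :=
        Finset.single_le_sum (f := fun i => ∑ j, A i j ^ 2)
          (fun _ _ => Finset.sum_nonneg fun _ _ => sq_nonneg _) (Finset.mem_univ i)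

variable {Ω : Type*} {m K r : ℕ} {D : Model Ω m K r}

lemma det_mul_transpose_ne_zero {P : Matrix (Fin m) (Fin K) ℝ} (hP : P.rank = m) :
    (P * Pᵀ).det ≠ 0 := by
  have h : (P * Pᵀ).rank = Fintype.card (Fin m) := by
    rw [rank_self_mul_transpose, hP, Fintype.card_fin]
  have hu : IsUnit (P * Pᵀ) := by
    rw [← Matrix.mulVec_surjective_iff_isUnit]
    have : LinearMap.range (P * Pᵀ).mulVecLin = ⊤ := by
      apply Submodule.eq_top_of_finrank_eq
      rw [← Matrix.rank, h]; simp
    exact LinearMap.range_eq_top.1 this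
  exact ((Matrix.isUnit_iff_isUnit_det _).1 hu).ne_zero

lemma FactorLoadings.abs_Pibar_le (h : FactorLoadings D) :
    ∃ C, ∀ N a b, |D.Pibar N a b| ≤ C := by
  obtain ⟨C, hC⟩ := h.bdd_Pi
  have hC0 : 0 ≤ C := (Real.sqrt_nonneg _).trans (hC 0)
  refine ⟨C, fun N a b => ?_⟩
  rw [Model.Pibar, Matrix.smul_apply, smul_eq_mul, Matrix.sum_apply, abs_mul, abs_inv, Nat.abs_cast]
  have : |∑ j ∈ Finset.range N, D.Pi j a b| ≤ N * C := by
    refine (Finset.abs_sum_le_sum_abs _ _).trans ?_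
    refine (Finset.sum_le_sum fun j _ => (abs_le_frobNorm _ a b).trans (hC j)).trans ?_
    simp
  rcases Nat.eq_zero_or_pos N with rfl | hN
  · simpa using hC0
  · rw [inv_mul_le_iff₀ (by exact_mod_cast hN)]
    exact this

/-- Since the averaged loadings are bounded and have rank `m` in the limit, their right inverses
are bounded, so the loadings of a unit are bounded combinations of the averaged ones. -/
lemma FactorLoadings.exists_bounded_preimage (h : FactorLoadings D) (v : Fin m → ℝ) :
    ∃ G : ℝ, ∀ᶠ N in atTop, ∃ g : Fin K → ℝ, D.Pibar N *ᵥ g = v ∧ ∀ a, |g a| ≤ G := by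
  -- `Qᵀ(QQᵀ)⁻¹v`, with the inverse as adjugate over determinant so that continuity is plain
  let φ : Matrix (Fin m) (Fin K) ℝ → (Fin K → ℝ) := fun Q =>
    ((Q * Qᵀ).det)⁻¹ • (Qᵀ *ᵥ ((Q * Qᵀ).adjugate *ᵥ v))
  have hφ : ∀ Q : Matrix (Fin m) (Fin K) ℝ, (Q * Qᵀ).det ≠ 0 → Q *ᵥ φ Q = v := by
    intro Q hQ
    simp only [φ]
    rw [mulVec_smul, mulVec_mulVec, mulVec_mulVec, mul_adjugate, smul_mulVec, one_mulVec, smul_smul,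
      inv_mul_cancel₀ hQ, one_smul]
  -- otherwise the preimages `φ` blow up along a subsequence, whose limit point has full rank
  by_contra! hcon
  obtain ⟨C, hC⟩ := h.abs_Pibar_le
  have hex : ∀ n : ℕ, ∃ N, n + 1 ≤ N ∧
      ∀ g : Fin K → ℝ, D.Pibar N *ᵥ g = v → ∃ a, (n : ℝ) < |g a| := by
    intro n
    obtain ⟨N, h1, h2⟩ := ((hcon n).and_eventually (eventually_ge_atTop (n + 1))).exists
    exact ⟨N, h2, h1⟩
  choose N hN1 hN2 using hex
  have hcomp : IsCompact (Set.pi Set.univ fun _ : Fin m => Set.pi Set.univ fun _ : Fin K =>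
      Set.Icc (-C) C) := isCompact_univ_pi fun _ => isCompact_univ_pi fun _ => isCompact_Icc
  obtain ⟨P₀, -, ψ, hψ, hP₀⟩ := hcomp.tendsto_subseq (x := fun n a b => D.Pibar (N n) a b)
    (fun n a _ b _ => abs_le.1 (hC _ a b))
  let P : Matrix (Fin m) (Fin K) ℝ := Matrix.of P₀
  have hP : Tendsto (fun n => D.Pibar (N (ψ n))) atTop (𝓝 P) := hP₀
  have hNtop : Tendsto (fun n => N (ψ n)) atTop atTop :=
    tendsto_atTop_mono (fun n => (Nat.le_succ _).trans (hN1 _)) hψ.tendsto_atTop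
  have hclus : MapClusterPt P atTop D.Pibar :=
    MapClusterPt.of_comp hNtop (Tendsto.mapClusterPt hP)
  have hdet := det_mul_transpose_ne_zero (h.rank_limit P hclus)
  have hid : Continuous fun Q : Matrix (Fin m) (Fin K) ℝ => Q := continuous_id
  have hgram : Continuous fun Q : Matrix (Fin m) (Fin K) ℝ => Q * Qᵀ :=
    hid.matrix_mul hid.matrix_transpose
  have hcont : ContinuousAt φ P :=
    ContinuousAt.smul (ContinuousAt.inv₀ hgram.matrix_det.continuousAt hdet)
      (hid.matrix_transpose.matrix_mulVec
        (hgram.matrix_adjugate.matrix_mulVec continuous_const)).continuousAt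
  have hlim : Tendsto (fun n => φ (D.Pibar (N (ψ n)))) atTop (𝓝 (φ P)) := hcont.tendsto.comp hP
  have hbd : ∀ᶠ n in atTop, ∀ a, |φ (D.Pibar (N (ψ n))) a| < (∑ a, |φ P a|) + 1 := by
    refine eventually_all.2 fun a => ?_
    have h1 := ((tendsto_pi_nhds.1 hlim) a).abs
    refine h1.eventually_lt_const ?_
    have := Finset.single_le_sum (f := fun a => |φ P a|) (fun _ _ => abs_nonneg _)
      (Finset.mem_univ a)
    linarith
  have hbig : ∀ᶠ n in atTop, (∑ a, |φ P a|) + 1 ≤ (ψ n : ℝ) :=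
    (tendsto_natCast_atTop_atTop.comp hψ.tendsto_atTop).eventually_ge_atTop _
  obtain ⟨n, h1, h2⟩ := (hbd.and hbig).exists
  have hr : (D.Pibar (N (ψ n)) * (D.Pibar (N (ψ n)))ᵀ).det ≠ 0 :=
    det_mul_transpose_ne_zero (h.rank _ ((Nat.le_add_left _ _).trans (hN1 _)))
  obtain ⟨a, ha⟩ := hN2 _ _ (hφ _ hr)
  linarith [h1 a]

end Loadings

namespace Model

variable {Ω : Type*} {m K r : ℕ} (D : Model Ω m K r)

/-- The cross-sectional average of the idiosyncratic parts of the regressors. -/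
def xibar (N T : ℕ) (ω : Ω) : Matrix (Fin T) (Fin K) ℝ :=
  Matrix.of fun s a => (N : ℝ)⁻¹ * ∑ j ∈ Finset.range N, D.ξ j (time s) ω a

lemma Xbar_eq (N T : ℕ) (ω : Ω) :
    D.Xbar N T ω = D.Fmat T ω * D.Pibar N + D.xibar N T ω := by
  ext s a
  simp only [Xbar, Pibar, xibar, Matrix.smul_apply, Matrix.add_apply, Matrix.mul_smul,
    Matrix.mul_sum, Matrix.sum_apply, smul_eq_mul, of_apply, ← mul_add, ← Finset.sum_add_distrib]
  congr 1
  refine Finset.sum_congr rfl fun j _ => ?_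
  simp [Xmat, x, Fmat, mulVec, Matrix.mul_apply, dotProduct, mul_comm]

/-- As `F Π̄ = X̄ - ξ̄`, projecting off `X̄` leaves only averaged idiosyncratic
parts of `F Π̄ g`. -/
lemma annihilator_factor_sq_le (N T : ℕ) (ω : Ω) {v : Fin m → ℝ} {g : Fin K → ℝ}
    (hg : D.Pibar N *ᵥ g = v) :
    (annihilator (D.Xbar N T ω) *ᵥ (D.Fmat T ω *ᵥ v)) ⬝ᵥ
      (annihilator (D.Xbar N T ω) *ᵥ (D.Fmat T ω *ᵥ v)) ≤
      (D.xibar N T ω *ᵥ g) ⬝ᵥ (D.xibar N T ω *ᵥ g) := by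
  have e : D.Fmat T ω *ᵥ v = D.Xbar N T ω *ᵥ g - D.xibar N T ω *ᵥ g := by
    rw [Xbar_eq, add_mulVec, ← mulVec_mulVec, hg, add_sub_cancel_right]
  rw [e, mulVec_sub, annihilator_mulVec_self, zero_sub, neg_dotProduct, dotProduct_neg, neg_neg]
  exact annihilator_sq_le _ _

end Model

section FactorBound

variable {Ω : Type*} [MeasurableSpace Ω] {m K r : ℕ} {μ : Measure Ω}
  {D : Model Ω m K r}

lemma Regressors.variance_le (hmeas : MeasurableData D) (h : Regressors μ D) :
    ∃ C, 0 ≤ C ∧ ∀ j t a, variance (fun ω => D.ξ j t ω a) μ ≤ C := by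
  obtain ⟨C, hC⟩ := h.cov_bdd
  refine ⟨C, (Real.sqrt_nonneg _).trans (hC 0), fun j t a => ?_⟩
  have hma : Measurable fun x : Fin K → ℝ => x a := measurable_pi_apply a
  have hm : Measurable fun ω => D.ξ j t ω a := hma.comp (hmeas.ξ j t)
  rw [← covariance_self hm.aemeasurable,
    (h.stationary j).covariance_eq (hmeas.ξ j) hma hma t t, sub_self]
  exact ((le_abs_self _).trans (abs_le_frobNorm (autocov μ (D.ξ j) 0) a a)).trans (hC j)

variable [IsProbabilityMeasure μ]

lemma Regressors.memLp_two (h : Regressors μ D) (j : ℕ) (t : ℤ) (a : Fin K) :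
    MemLp (fun ω => D.ξ j t ω a) 2 μ := by
  obtain ⟨κ, hκ, hm⟩ := h.moment
  have h1 : MemLp (fun ω => D.ξ j t ω a) (ENNReal.ofReal (4 + κ)) μ :=
    memLp_pi_iff.1 (hm j t) a
  refine h1.mono_exponent ?_
  rw [show (2 : ℝ≥0∞) = ENNReal.ofReal 2 by simp]
  exact ENNReal.ofReal_le_ofReal (by linarith)

lemma Regressors.integral_eq_zero (hmeas : MeasurableData D) (h : Regressors μ D) (j : ℕ) (t : ℤ)
    (a : Fin K) : ∫ ω, D.ξ j t ω a ∂μ = 0 :=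
  integral_eq_zero_of_condExp_ae_eq_zero (iSup_le fun _ => (hmeas.ξ _ _).comap_le)
    (h.cond_mean (j + 1) j t (Nat.lt_succ_self j) a)

lemma Regressors.lintegral_xibar_le (hmeas : MeasurableData D) (h : Regressors μ D) {C : ℝ}
    (hC : ∀ j t a, variance (fun ω => D.ξ j t ω a) μ ≤ C) {N : ℕ} (hN : 0 < N) (T : ℕ)
    (s : Fin T) (a : Fin K) :
    ∫⁻ ω, ENNReal.ofReal (D.xibar N T ω s a ^ 2) ∂μ ≤ ENNReal.ofReal (C / N) := by
  have hN' : (0 : ℝ) < N := by exact_mod_cast hN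
  have hsum : MemLp (∑ j ∈ Finset.range N, fun ω => D.ξ j (Model.time s) ω a) 2 μ :=
    memLp_finsetSum' _ fun j _ => h.memLp_two j _ a
  have heq : (fun ω => D.xibar N T ω s a) =
      (N : ℝ)⁻¹ • ∑ j ∈ Finset.range N, fun ω => D.ξ j (Model.time s) ω a := by
    ext ω
    simp [Model.xibar, Finset.sum_apply]
  have hL : MemLp (fun ω => D.xibar N T ω s a) 2 μ := by
    rw [heq]; exact hsum.const_smul _
  have h0 : ∫ ω, D.xibar N T ω s a ∂μ = 0 := by
    simp only [Model.xibar, of_apply]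
    rw [integral_const_mul, integral_finsetSum _ fun j _ =>
      (h.memLp_two j _ a).integrable (by norm_num)]
    simp [h.integral_eq_zero hmeas]
  rw [lintegral_ofReal_sq hL h0]
  refine ENNReal.ofReal_le_ofReal ?_
  rw [heq, variance_smul, IndepFun.variance_sum (fun j _ => h.memLp_two j _ a)]
  · have : ∑ j ∈ Finset.range N, variance (fun ω => D.ξ j (Model.time s) ω a) μ ≤ N * C := by
      refine (Finset.sum_le_sum fun j _ => hC j _ a).trans ?_
      simp
    calc ((N : ℝ)⁻¹) ^ 2 * _ ≤ ((N : ℝ)⁻¹) ^ 2 * (N * C) := by gcongr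
      _ = C / N := by field_simp
  · intro j _ k _ hjk
    have hm : Measurable fun x : ℤ → Fin K → ℝ => x (Model.time s) a := by fun_prop
    exact (h.indep.indepFun hjk).comp hm hm

/-- The projection off the averages nearly annihilates the factors: the mean square of what is left
is of order `1 / N`, with no condition on `T`. -/
lemma tendsto_factor_part (hmeas : MeasurableData D) (hl : FactorLoadings D)
    (h : Regressors μ D) (v : Fin m → ℝ) {κ : ℝ} (hκ : 0 < κ) :
    Tendsto (fun n : ℕ × ℕ => μ {ω | κ * n.2 <
      (annihilator (D.Xbar n.1 n.2 ω) *ᵥ (D.Fmat n.2 ω *ᵥ v)) ⬝ᵥ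
        (annihilator (D.Xbar n.1 n.2 ω) *ᵥ (D.Fmat n.2 ω *ᵥ v))}) atTop (𝓝 0) := by
  obtain ⟨C, hC0, hC⟩ := h.variance_le hmeas
  obtain ⟨G, hG⟩ := hl.exists_bounded_preimage v
  have hlim : Tendsto (fun n : ℕ × ℕ => ENNReal.ofReal (K * G ^ 2 * K * C / κ / n.1)) atTop
      (𝓝 0) := by
    have h1 : Tendsto (fun n : ℕ × ℕ => n.1) atTop atTop := by
      rw [← prod_atTop_atTop_eq]; exact tendsto_fst
    have h2 := (tendsto_const_div_atTop_nhds_zero_nat (K * G ^ 2 * K * C / κ)).comp h1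
    simpa using ENNReal.tendsto_ofReal h2
  refine tendsto_of_tendsto_of_tendsto_of_le_of_le' tendsto_const_nhds hlim
    (Eventually.of_forall fun _ => zero_le) ?_
  have hev : ∀ᶠ n : ℕ × ℕ in atTop, (∃ g : Fin K → ℝ, D.Pibar n.1 *ᵥ g = v ∧ ∀ a, |g a| ≤ G) ∧
      0 < n.1 ∧ 0 < n.2 := by
    rw [← prod_atTop_atTop_eq]
    exact ((hG.and (eventually_gt_atTop 0)).prod_mk (eventually_gt_atTop 0)).mono
      fun n hn => ⟨hn.1.1, hn.1.2, hn.2⟩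
  filter_upwards [hev] with n hn
  obtain ⟨⟨g, hg, hgG⟩, hN, hT⟩ := hn
  have hN' : (0 : ℝ) < n.1 := by exact_mod_cast hN
  have hT' : (0 : ℝ) < n.2 := by exact_mod_cast hT
  have hxm : ∀ s a, Measurable fun ω => D.xibar n.1 n.2 ω s a := by
    intro s a
    simp only [Model.xibar, of_apply]
    exact (Finset.measurable_sum _ fun j _ =>
      (measurable_pi_apply a).comp (hmeas.ξ j _)).const_mul _
  have hgs : ∑ a, g a ^ 2 ≤ K * G ^ 2 := by
    calc ∑ a, g a ^ 2 ≤ ∑ _a : Fin K, G ^ 2 :=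
          Finset.sum_le_sum fun a _ => sq_le_sq' (abs_le.1 (hgG a)).1 (abs_le.1 (hgG a)).2
      _ = K * G ^ 2 := by simp
  have hpt : ∀ ω, (D.xibar n.1 n.2 ω *ᵥ g) ⬝ᵥ (D.xibar n.1 n.2 ω *ᵥ g) ≤
      K * G ^ 2 * ∑ s, ∑ a, D.xibar n.1 n.2 ω s a ^ 2 := by
    intro ω
    rw [dotProduct, Finset.mul_sum]
    refine Finset.sum_le_sum fun s _ => ?_
    have := dotProduct_sq_le (fun a => D.xibar n.1 n.2 ω s a) g
    simp only [mulVec]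
    rw [← sq]
    refine this.trans ?_
    rw [mul_comm]
    simp only [dotProduct, ← sq]
    exact mul_le_mul_of_nonneg_right hgs (Finset.sum_nonneg fun _ _ => sq_nonneg _)
  have hint : ∫⁻ ω, ∑ s, ∑ a, ENNReal.ofReal (D.xibar n.1 n.2 ω s a ^ 2) ∂μ ≤
      ENNReal.ofReal (n.2 * (K * (C / n.1))) := by
    rw [lintegral_finsetSum _ fun s _ => Finset.measurable_sum _ fun a _ =>
      ((hxm s a).pow_const 2).ennreal_ofReal]
    calc _ ≤ ∑ _s : Fin n.2, ∑ _a : Fin K, ENNReal.ofReal (C / n.1) := by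
          refine Finset.sum_le_sum fun s _ => ?_
          rw [lintegral_finsetSum _ fun a _ => ((hxm s a).pow_const 2).ennreal_ofReal]
          exact Finset.sum_le_sum fun a _ => h.lintegral_xibar_le hmeas hC hN n.2 s a
      _ = _ := by
          simp only [Finset.sum_const, Finset.card_univ, Fintype.card_fin, nsmul_eq_mul]
          rw [ENNReal.ofReal_mul (by positivity), ENNReal.ofReal_mul (by positivity)]
          simp
  have hKG : 0 ≤ K * G ^ 2 := by positivity
  calc μ {ω | κ * n.2 < _} ≤ μ {ω | ENNReal.ofReal (κ * n.2) ≤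
        ENNReal.ofReal (K * G ^ 2) * ∑ s, ∑ a, ENNReal.ofReal (D.xibar n.1 n.2 ω s a ^ 2)} := by
        refine measure_mono fun ω hω => ?_
        simp only [Set.mem_ofPred_eq] at hω ⊢
        have h1 := (hω.le.trans (D.annihilator_factor_sq_le n.1 n.2 ω hg)).trans (hpt ω)
        refine (ENNReal.ofReal_le_ofReal h1).trans_eq ?_
        rw [ENNReal.ofReal_mul hKG, ENNReal.ofReal_sum_of_nonneg
          (f := fun s => ∑ a, D.xibar n.1 n.2 ω s a ^ 2) fun _ _ =>
            Finset.sum_nonneg fun _ _ => sq_nonneg _]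
        congr 1
        exact Finset.sum_congr rfl fun s _ => ENNReal.ofReal_sum_of_nonneg fun _ _ => sq_nonneg _
    _ ≤ (∫⁻ ω, ENNReal.ofReal (K * G ^ 2) *
          ∑ s, ∑ a, ENNReal.ofReal (D.xibar n.1 n.2 ω s a ^ 2) ∂μ) / ENNReal.ofReal (κ * n.2) := by
        refine meas_ge_le_lintegral_div ?_ (by simpa using mul_pos hκ hT') ENNReal.ofReal_ne_top
        exact (Measurable.const_mul (Finset.measurable_sum _ fun s _ =>
          Finset.measurable_sum _ fun a _ => ((hxm s a).pow_const 2).ennreal_ofReal) _).aemeasurable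
    _ ≤ ENNReal.ofReal (K * G ^ 2) * ENNReal.ofReal (n.2 * (K * (C / n.1))) /
          ENNReal.ofReal (κ * n.2) := by
        rw [lintegral_const_mul _ (Finset.measurable_sum _ fun s _ =>
          Finset.measurable_sum _ fun a _ => ((hxm s a).pow_const 2).ennreal_ofReal)]
        gcongr
    _ = ENNReal.ofReal (K * G ^ 2 * K * C / κ / n.1) := by
        rw [← ENNReal.ofReal_mul hKG, ← ENNReal.ofReal_div_of_pos (by positivity)]
        congr 1
        field_simp

end FactorBound

/-! ### Projections of the errors for a fixed design -/

section Design

variable {T : ℕ} {ι κ : Type*} [Fintype ι] [Fintype κ]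

/-- `G a + 1{q ≤ γ} H b`, a vector in the column space of the threshold design: the columns of `G`
do not depend on the threshold, those of `H` are switched by `q ≤ γ`. -/
def designVec (G : Matrix (Fin T) ι ℝ) (H : Matrix (Fin T) κ ℝ) (q : Fin T → ℝ) (γ : ℝ)
    (a : ι → ℝ) (b : κ → ℝ) : Fin T → ℝ :=
  fun s => (G *ᵥ a) s + if q s ≤ γ then (H *ᵥ b) s else 0

/-- The vectors `e` for which the projection of `e` on the column space of the design has, at some
threshold, a squared norm above `k`. It is expressed through inner products with vectors of the
column space, which needs no rank condition and makes measurability in the design accessible. -/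
def exceptionalSet (k : ℝ) (G : Matrix (Fin T) ι ℝ) (H : Matrix (Fin T) κ ℝ) (q : Fin T → ℝ) :
    Set (Fin T → ℝ) :=
  {e | ∃ γ a b, k * (designVec G H q γ a b ⬝ᵥ designVec G H q γ a b) <
    (designVec G H q γ a b ⬝ᵥ e) ^ 2}

/-- The position of each time when the times are ordered by the value of `q`, ties broken. -/
def sortRank (q : Fin T → ℝ) (s : Fin T) : ℕ := ((Tuple.sort q).symm s : ℕ)

lemma sortRank_injective (q : Fin T → ℝ) : Function.Injective (sortRank q) :=
  fun _ _ h => (Tuple.sort q).symm.injective (Fin.ext h)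

/-- The times with `q ≤ γ` are an initial segment in the order of `q`. -/
lemma exists_le_iff_sortRank_lt (q : Fin T → ℝ) (γ : ℝ) :
    ∃ k ≤ T, ∀ s, q s ≤ γ ↔ sortRank q s < k := by
  refine ⟨Finset.card {j | (q ∘ Tuple.sort q) j ≤ γ}, ?_, fun s => ?_⟩
  · simpa using Finset.card_le_univ ({j | (q ∘ Tuple.sort q) j ≤ γ} : Finset (Fin T))
  · have := Tuple.lt_card_le_iff_apply_le_of_monotone (f := q ∘ Tuple.sort q) (a := γ)
      (j := (Tuple.sort q).symm s) (Tuple.monotone_sort q)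
    simpa [sortRank] using this.symm

/-- The `l`-th cell of `n` consecutive times in the order of `q`. -/
def cell (q : Fin T → ℝ) (n l : ℕ) : Finset (Fin T) := {s | sortRank q s / n = l}

lemma card_cell_le (q : Fin T → ℝ) {n : ℕ} (hn : 0 < n) (l : ℕ) : (cell q n l).card ≤ n := by
  calc (cell q n l).card ≤ (Finset.Ico (l * n) ((l + 1) * n)).card := by
        refine Finset.card_le_card_of_injOn (sortRank q) (fun s hs => ?_)
          (sortRank_injective q).injOn
        have hs' : sortRank q s / n = l := by simpa [cell] using hs
        rw [Nat.div_eq_iff hn] at hs'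
        simp only [Finset.coe_Ico, Set.mem_Ico]
        rw [add_mul]
        omega
    _ = n := by simp [add_mul]

variable {ν : Measure (Fin T → ℝ)}

/-- Markov's inequality for the projection of a vector with bounded covariance matrix on a fixed
space of small dimension. -/
lemma measure_exists_span_le {J : Type*} [Fintype J] {C k : ℝ} (hk : 0 < k)
    (h2 : ∀ a : Fin T → ℝ, ∫⁻ e, ENNReal.ofReal ((a ⬝ᵥ e) ^ 2) ∂ν ≤ ENNReal.ofReal (C * (a ⬝ᵥ a)))
    (w : J → Fin T → ℝ) :
    ν {e | ∃ c : J → ℝ, k * ((∑ j, c j • w j) ⬝ᵥ (∑ j, c j • w j)) <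
        ((∑ j, c j • w j) ⬝ᵥ e) ^ 2} ≤
      Fintype.card J * ENNReal.ofReal (C / k) := by
  let V : Submodule ℝ (EuclideanSpace ℝ (Fin T)) :=
    Submodule.span ℝ (Set.range fun j => WithLp.toLp 2 (w j))
  let b := stdOrthonormalBasis ℝ V
  have hd : Module.finrank ℝ V ≤ Fintype.card J := finrank_range_le_card _
  let u : Fin (Module.finrank ℝ V) → Fin T → ℝ := fun l => (b l : EuclideanSpace ℝ (Fin T)).ofLp
  have hu : ∀ l, u l ⬝ᵥ u l = 1 := by
    intro l
    have h := b.orthonormal.1 l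
    have h' : inner ℝ (b l : EuclideanSpace ℝ (Fin T)) (b l) = (1 : ℝ) := by
      rw [real_inner_self_eq_norm_sq]
      have : ‖(b l : EuclideanSpace ℝ (Fin T))‖ = 1 := h
      rw [this]; norm_num
    rwa [EuclideanSpace.inner_eq_star_dotProduct, star_trivial] at h'
  have hm : ∀ l, Measurable fun e : Fin T → ℝ => ENNReal.ofReal ((u l ⬝ᵥ e) ^ 2) := by
    intro l
    simp only [dotProduct]
    fun_prop
  have hincl : {e : Fin T → ℝ | ∃ c : J → ℝ, k * ((∑ j, c j • w j) ⬝ᵥ (∑ j, c j • w j)) <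
        ((∑ j, c j • w j) ⬝ᵥ e) ^ 2} ⊆
      {e | ENNReal.ofReal k ≤ ∑ l, ENNReal.ofReal ((u l ⬝ᵥ e) ^ 2)} := by
    rintro e ⟨c, hc⟩
    set v := ∑ j, c j • w j with hv
    have hvV : WithLp.toLp 2 v ∈ V := by
      rw [hv, WithLp.toLp_sum]
      exact Submodule.sum_mem _ fun j _ => by
        rw [WithLp.toLp_smul]
        exact Submodule.smul_mem _ _ (Submodule.subset_span ⟨j, rfl⟩)
    have hrep := b.sum_repr ⟨WithLp.toLp 2 v, hvV⟩
    have hnorm := b.repr.norm_map ⟨WithLp.toLp 2 v, hvV⟩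
    set x := b.repr ⟨WithLp.toLp 2 v, hvV⟩
    have hv1 : v = ∑ l, x l • u l := by
      have := congrArg (fun z : V => (z : EuclideanSpace ℝ (Fin T)).ofLp) hrep
      simp only at this
      rw [← this]
      simp [u]
    have hv2 : v ⬝ᵥ v = ∑ l, x l ^ 2 := by
      have h1 : ‖WithLp.toLp 2 v‖ ^ 2 = v ⬝ᵥ v := by
        rw [EuclideanSpace.real_norm_sq_eq]; simp [dotProduct, sq]
      have h2 : ‖x‖ = ‖WithLp.toLp 2 v‖ := hnorm
      rw [← h1, ← h2, EuclideanSpace.real_norm_sq_eq]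
    have hle : (v ⬝ᵥ e) ^ 2 ≤ (v ⬝ᵥ v) * ∑ l, (u l ⬝ᵥ e) ^ 2 := by
      rw [hv2, hv1, sum_dotProduct]
      simp only [smul_dotProduct, smul_eq_mul]
      exact Finset.sum_mul_sq_le_sq_mul_sq _ _ _
    have hpos : 0 < v ⬝ᵥ v := by
      refine (dotProduct_self_nonneg_real v).lt_of_ne fun h0 => ?_
      rw [← h0] at hc hle
      linarith
    have : k < ∑ l, (u l ⬝ᵥ e) ^ 2 := by
      have := hc.trans_le hle
      rw [mul_comm] at this
      exact lt_of_mul_lt_mul_left this hpos.le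
    simp only [Set.mem_ofPred_eq]
    rw [← ENNReal.ofReal_sum_of_nonneg fun _ _ => sq_nonneg _]
    exact ENNReal.ofReal_le_ofReal this.le
  refine (measure_mono hincl).trans ((meas_ge_le_lintegral_div
    (Finset.measurable_sum _ fun l _ => hm l).aemeasurable (by simpa using hk)
      ENNReal.ofReal_ne_top).trans ?_)
  rw [lintegral_finsetSum _ fun l _ => hm l]
  calc (∑ l, ∫⁻ e, ENNReal.ofReal ((u l ⬝ᵥ e) ^ 2) ∂ν) / ENNReal.ofReal k
      ≤ (∑ _l : Fin (Module.finrank ℝ V), ENNReal.ofReal C) / ENNReal.ofReal k := by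
        gcongr with l
        refine (h2 (u l)).trans_eq ?_
        rw [hu, mul_one]
    _ ≤ Fintype.card J * ENNReal.ofReal C / ENNReal.ofReal k := by
        simp only [Finset.sum_const, Finset.card_univ, Fintype.card_fin, nsmul_eq_mul]
        gcongr
    _ = _ := by rw [ENNReal.ofReal_div_of_pos hk, mul_div_assoc]

/-- Markov's inequality with fourth moments for the errors on a set of at most `n` times. -/
lemma measure_sum_sq_le {M k : ℝ} (hk : 0 < k)
    (h4 : ∀ s, ∫⁻ e, ENNReal.ofReal (e s ^ 4) ∂ν ≤ ENNReal.ofReal M)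
    (A : Finset (Fin T)) {n : ℕ} (hA : A.card ≤ n) :
    ν {e | k < ∑ s ∈ A, e s ^ 2} ≤ ENNReal.ofReal (n ^ 2 * M / k ^ 2) := by
  have hm : ∀ s, Measurable fun e : Fin T → ℝ => ENNReal.ofReal (e s ^ 4) := by
    intro s; fun_prop
  have hincl : {e : Fin T → ℝ | k < ∑ s ∈ A, e s ^ 2} ⊆
      {e | ENNReal.ofReal (k ^ 2) ≤ n * ∑ s ∈ A, ENNReal.ofReal (e s ^ 4)} := by
    intro e he
    simp only [Set.mem_ofPred_eq] at he ⊢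
    have h1 : (∑ s ∈ A, e s ^ 2) ^ 2 ≤ A.card * ∑ s ∈ A, (e s ^ 2) ^ 2 := sq_sum_le_card_mul_sum_sq
    have h2 : k ^ 2 ≤ n * ∑ s ∈ A, e s ^ 4 := by
      calc k ^ 2 ≤ (∑ s ∈ A, e s ^ 2) ^ 2 := by gcongr
        _ ≤ A.card * ∑ s ∈ A, (e s ^ 2) ^ 2 := h1
        _ ≤ n * ∑ s ∈ A, (e s ^ 2) ^ 2 := by gcongr
        _ = n * ∑ s ∈ A, e s ^ 4 := by simp only [← pow_mul]
    refine (ENNReal.ofReal_le_ofReal h2).trans_eq ?_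
    rw [ENNReal.ofReal_mul (by positivity), ENNReal.ofReal_sum_of_nonneg fun _ _ => by positivity,
      ENNReal.ofReal_natCast]
  refine (measure_mono hincl).trans ((meas_ge_le_lintegral_div
    ((Finset.measurable_sum _ fun l _ => hm l).const_mul _).aemeasurable
      (by simp [hk.ne']) ENNReal.ofReal_ne_top).trans ?_)
  rw [lintegral_const_mul _ (Finset.measurable_sum _ fun l _ => hm l),
    lintegral_finsetSum _ fun l _ => hm l]
  calc (n * ∑ s ∈ A, ∫⁻ e, ENNReal.ofReal (e s ^ 4) ∂ν) / ENNReal.ofReal (k ^ 2)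
      ≤ (n * ∑ _s ∈ A, ENNReal.ofReal M) / ENNReal.ofReal (k ^ 2) := by
        gcongr with s; exact h4 s
    _ ≤ (n * (n * ENNReal.ofReal M)) / ENNReal.ofReal (k ^ 2) := by
        simp only [Finset.sum_const, nsmul_eq_mul]
        gcongr
    _ = _ := by
        rw [ENNReal.ofReal_div_of_pos (by positivity), ENNReal.ofReal_mul (by positivity),
          sq (n : ℝ), ENNReal.ofReal_mul (by positivity), ENNReal.ofReal_natCast, mul_assoc]

/-- For a fixed design, the projections on the column spaces at the different thresholds are
controlled jointly: off one cell, the indicator of `q ≤ γ` is one of a few fixed sets, and the part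
of the errors in a small cell is small. -/
lemma measure_exceptionalSet_le_cells {C M k : ℝ} (hk : 0 < k)
    (h2 : ∀ a : Fin T → ℝ, ∫⁻ e, ENNReal.ofReal ((a ⬝ᵥ e) ^ 2) ∂ν ≤ ENNReal.ofReal (C * (a ⬝ᵥ a)))
    (h4 : ∀ s, ∫⁻ e, ENNReal.ofReal (e s ^ 4) ∂ν ≤ ENNReal.ofReal M)
    (G : Matrix (Fin T) ι ℝ) (H : Matrix (Fin T) κ ℝ) (q : Fin T → ℝ) {n : ℕ} (hn : 0 < n) :
    ν (exceptionalSet k G H q) ≤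
      (T / n + 1 : ℕ) * (Fintype.card (ι ⊕ κ) * ENNReal.ofReal (C / (k / 4)) +
      ENNReal.ofReal (n ^ 2 * M / (k / 4) ^ 2)) := by
  classical
  -- the columns of the design with the times of the cell `l` removed
  let w : ℕ → ι ⊕ κ → Fin T → ℝ := fun l j s => if s ∈ cell q n l then 0 else
    Sum.elim (fun j => G s j) (fun j => if sortRank q s < l * n then H s j else 0) j
  have hincl : exceptionalSet k G H q ⊆ ⋃ l ∈ Finset.range (T / n + 1),
      ({e | ∃ c : ι ⊕ κ → ℝ, k / 4 * ((∑ j, c j • w l j) ⬝ᵥ (∑ j, c j • w l j)) <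
        ((∑ j, c j • w l j) ⬝ᵥ e) ^ 2} ∪ {e | k / 4 < ∑ s ∈ cell q n l, e s ^ 2}) := by
    rintro e ⟨γ, a, b, he⟩
    obtain ⟨r, hrT, hr⟩ := exists_le_iff_sortRank_lt q γ
    set v := designVec G H q γ a b with hv
    set l := r / n with hl
    simp only [Set.mem_iUnion, Finset.mem_range]
    refine ⟨l, Nat.lt_succ_of_le (Nat.div_le_div_right hrT), ?_⟩
    by_contra hcon
    simp only [Set.mem_union, Set.mem_ofPred_eq, not_or, not_exists, not_lt] at hcon
    obtain ⟨hc1, hc2⟩ := hcon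
    have hv1 : ∑ j, (Sum.elim a b j) • w l j = fun s => if s ∈ cell q n l then 0 else v s := by
      ext s
      rw [Finset.sum_apply]
      simp only [Pi.smul_apply, smul_eq_mul, Fintype.sum_sum_type, Sum.elim_inl, Sum.elim_inr, w]
      by_cases h : s ∈ cell q n l
      · simp [h]
      · have hiff : sortRank q s < r ↔ sortRank q s < l * n := by
          have hne : sortRank q s / n ≠ r / n := by simpa [cell, hl] using h
          constructor
          · intro h'
            rw [← Nat.div_lt_iff_lt_mul hn]
            exact lt_of_le_of_ne (Nat.div_le_div_right h'.le) hne
          · exact fun h' => h'.trans_le (Nat.div_mul_le_self r n)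
        simp only [if_neg h]
        by_cases hq : q s ≤ γ
        · rw [hv, designVec, if_pos hq]
          rw [hr, hiff] at hq
          simp only [if_pos hq, mulVec, dotProduct]
          congr 1 <;> exact Finset.sum_congr rfl fun _ _ => mul_comm _ _
        · rw [hv, designVec, if_neg hq]
          rw [hr, hiff] at hq
          simp only [if_neg hq, mulVec, dotProduct, mul_zero, Finset.sum_const_zero, add_zero]
          exact Finset.sum_congr rfl fun _ _ => mul_comm _ _
    have h1 := hc1 (Sum.elim a b)
    rw [hv1] at h1
    have hsplit : ∀ f : Fin T → ℝ, ∑ s, f s =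
        ∑ s, (if s ∈ cell q n l then 0 else f s) + ∑ s ∈ cell q n l, f s := by
      intro f
      rw [← Finset.sum_filter_not_add_sum_filter Finset.univ (· ∈ cell q n l) f,
        Finset.sum_filter]
      congr 1
      · exact Finset.sum_congr rfl fun s _ => by simp
      · exact Finset.sum_congr (by ext; simp) fun _ _ => rfl
    set v1 : Fin T → ℝ := fun s => if s ∈ cell q n l then 0 else v s
    -- `⟨v, e⟩` and `‖v‖²` are split into the times off the cell and those in it
    set y := ∑ s ∈ cell q n l, v s * e s
    set z := ∑ s ∈ cell q n l, v s ^ 2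
    have hd1 : v ⬝ᵥ e = v1 ⬝ᵥ e + y := by
      rw [dotProduct, hsplit, dotProduct]
      congr 1
      exact Finset.sum_congr rfl fun s _ => by simp only [v1]; split_ifs <;> simp
    have hd2 : v ⬝ᵥ v = v1 ⬝ᵥ v1 + z := by
      rw [dotProduct, hsplit, dotProduct]
      congr 1
      · exact Finset.sum_congr rfl fun s _ => by simp only [v1]; split_ifs <;> simp
      · exact Finset.sum_congr rfl fun s _ => (sq _).symm
    have hz0 : 0 ≤ z := Finset.sum_nonneg fun _ _ => sq_nonneg _
    have hy2 : y ^ 2 ≤ z * (k / 4) :=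
      (Finset.sum_mul_sq_le_sq_mul_sq _ _ _).trans (mul_le_mul_of_nonneg_left hc2 hz0)
    rw [hd1, hd2] at he
    have hv0 := dotProduct_self_nonneg_real v1
    nlinarith [sq_nonneg (v1 ⬝ᵥ e - y), mul_nonneg hk.le hz0, mul_nonneg hk.le hv0]
  refine (measure_mono hincl).trans ((measure_biUnion_finset_le _ _).trans ?_)
  calc _ ≤ ∑ _l ∈ Finset.range (T / n + 1), (Fintype.card (ι ⊕ κ) * ENNReal.ofReal (C / (k / 4)) +
      ENNReal.ofReal (n ^ 2 * M / (k / 4) ^ 2)) := by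
        refine Finset.sum_le_sum fun l _ => (measure_union_le _ _).trans ?_
        exact add_le_add (measure_exists_span_le (by positivity) h2 (w l))
          (measure_sum_sq_le (by positivity) h4 _ (card_cell_le q hn l))
    _ = _ := by rw [Finset.sum_const, Finset.card_range, nsmul_eq_mul]

/-- Cells of about `√T` times balance the number of cells against the errors inside one cell. -/
lemma measure_exceptionalSet_le {C M k : ℝ} (hk : 0 < k) (hM : 0 ≤ M) (hC : 0 ≤ C) (hT : 0 < T)
    (h2 : ∀ a : Fin T → ℝ, ∫⁻ e, ENNReal.ofReal ((a ⬝ᵥ e) ^ 2) ∂ν ≤ ENNReal.ofReal (C * (a ⬝ᵥ a)))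
    (h4 : ∀ s, ∫⁻ e, ENNReal.ofReal (e s ^ 4) ∂ν ≤ ENNReal.ofReal M)
    (G : Matrix (Fin T) ι ℝ) (H : Matrix (Fin T) κ ℝ) (q : Fin T → ℝ) :
    ν (exceptionalSet (k * T) G H q) ≤
      ENNReal.ofReal ((8 * Fintype.card (ι ⊕ κ) * C / k + 128 * M / k ^ 2) / Real.sqrt T) := by
  have hT' : (0 : ℝ) < T := by exact_mod_cast hT
  set R := Real.sqrt T
  have hR1 : 1 ≤ R := Real.one_le_sqrt.2 (by exact_mod_cast hT)
  have hRR : R * R = T := Real.mul_self_sqrt hT'.le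
  set n := Nat.sqrt T + 1 with hn
  have hn0 : 0 < n := Nat.succ_pos _
  have hnR : R ≤ n := Real.sqrt_le_left (by positivity) |>.2 (by
    have := Nat.lt_succ_sqrt T
    have h : T ≤ n ^ 2 := by rw [sq]; exact this.le
    exact_mod_cast h)
  have hn2 : (n : ℝ) ≤ 2 * R := by
    have := Real.nat_sqrt_le_real_sqrt (a := T)
    rw [hn]; push_cast; linarith
  have hcells : ((T / n + 1 : ℕ) : ℝ) ≤ 2 * R := by
    have h1 : ((T / n : ℕ) : ℝ) ≤ (T : ℝ) / n := Nat.cast_div_le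
    have h2 : (T : ℝ) / n ≤ R := by
      rw [div_le_iff₀ (by positivity), ← hRR]
      gcongr
    push_cast; linarith
  refine (measure_exceptionalSet_le_cells (mul_pos hk hT') h2 h4 G H q hn0).trans ?_
  set d := Fintype.card (ι ⊕ κ)
  rw [← ENNReal.ofReal_natCast d, ← ENNReal.ofReal_natCast (T / n + 1),
    ← ENNReal.ofReal_mul (by positivity), ← ENNReal.ofReal_add (by positivity) (by positivity),
    ← ENNReal.ofReal_mul (by positivity)]
  refine ENNReal.ofReal_le_ofReal ?_
  calc _ ≤ 2 * R * (d * (C / (k * T / 4)) + (2 * R) ^ 2 * M / (k * T / 4) ^ 2) := by gcongr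
    _ = _ := by
      rw [← hRR]
      field_simp
      ring

end Design

/-! ### Random designs independent of the errors -/

section RandomDesign

variable {T : ℕ} {ι κ : Type*} [Fintype ι] [Fintype κ]

lemma exists_rat_le_iff (q : Fin T → ℝ) (γ : ℝ) : ∃ g : ℚ, ∀ s, q s ≤ g ↔ q s ≤ γ := by
  have h : ∀ᶠ x in 𝓝[>] γ, ∀ s, γ < q s → x < q s := by
    refine eventually_all.2 fun s => ?_
    by_cases hs : γ < q s
    · filter_upwards [nhdsWithin_le_nhds (eventually_lt_nhds hs)] with x hx _ using hx
    · exact Eventually.of_forall fun x hx => absurd hx hs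
  obtain ⟨x, hx, hγx⟩ := (h.and self_mem_nhdsWithin).exists
  obtain ⟨g, h1, h2⟩ := exists_rat_btwn (show γ < x from hγx)
  refine ⟨g, fun s => ⟨fun hs => ?_, fun hs => hs.trans h1.le⟩⟩
  by_contra hcon
  exact absurd (hx s (not_le.1 hcon)) (not_lt.2 (hs.trans h2.le))

/-- Rational thresholds and coefficients suffice in the definition of the exceptional set. -/
lemma measurableSet_exceptionalSet (k : ℝ) :
    MeasurableSet {p : ((Fin T → ι → ℝ) × (Fin T → κ → ℝ) × (Fin T → ℝ)) × (Fin T → ℝ) |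
      p.2 ∈ exceptionalSet k (Matrix.of p.1.1) (Matrix.of p.1.2.1) p.1.2.2} := by
  have heq : {p : ((Fin T → ι → ℝ) × (Fin T → κ → ℝ) × (Fin T → ℝ)) × (Fin T → ℝ) |
      p.2 ∈ exceptionalSet k (Matrix.of p.1.1) (Matrix.of p.1.2.1) p.1.2.2} =
      ⋃ (g : ℚ) (a : ι → ℚ) (b : κ → ℚ), {p |
        k * (designVec (Matrix.of p.1.1) (Matrix.of p.1.2.1) p.1.2.2 g (fun j => a j) (fun j => b j)
          ⬝ᵥ designVec (Matrix.of p.1.1) (Matrix.of p.1.2.1) p.1.2.2 g (fun j => a j)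
            (fun j => b j)) <
        (designVec (Matrix.of p.1.1) (Matrix.of p.1.2.1) p.1.2.2 g (fun j => a j) (fun j => b j)
          ⬝ᵥ p.2) ^ 2} := by
    ext ⟨⟨G, H, q⟩, e⟩
    simp only [Set.mem_ofPred_eq, Set.mem_iUnion, exceptionalSet]
    constructor
    · rintro ⟨γ, a, b, h⟩
      obtain ⟨g, hg⟩ := exists_rat_le_iff q γ
      have hgv : ∀ a b, designVec (Matrix.of G) (Matrix.of H) q γ a b =
          designVec (Matrix.of G) (Matrix.of H) q g a b := by
        intro a b
        ext s
        simp only [designVec, hg]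
      rw [hgv] at h
      have hc : Continuous fun c : (ι → ℝ) × (κ → ℝ) =>
          designVec (Matrix.of G) (Matrix.of H) q g c.1 c.2 := by
        refine continuous_pi fun s => ?_
        simp only [designVec, mulVec, dotProduct]
        split_ifs <;> fun_prop
      have hopen : IsOpen {c : (ι → ℝ) × (κ → ℝ) |
          k * (designVec (Matrix.of G) (Matrix.of H) q g c.1 c.2 ⬝ᵥ
            designVec (Matrix.of G) (Matrix.of H) q g c.1 c.2) <
          (designVec (Matrix.of G) (Matrix.of H) q g c.1 c.2 ⬝ᵥ e) ^ 2} :=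
        isOpen_lt (continuous_const.mul (hc.dotProduct hc)) ((hc.dotProduct continuous_const).pow 2)
      have hdense : DenseRange (Prod.map (Pi.map fun _ : ι => ((↑) : ℚ → ℝ))
          (Pi.map fun _ : κ => ((↑) : ℚ → ℝ))) :=
        (DenseRange.piMap fun _ => Rat.denseRange_cast).prodMap
          (DenseRange.piMap fun _ => Rat.denseRange_cast)
      obtain ⟨c, hc⟩ := hdense.exists_mem_open hopen ⟨(a, b), h⟩
      exact ⟨g, c.1, c.2, hc⟩
    · rintro ⟨g, a, b, h⟩
      exact ⟨g, _, _, h⟩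
  rw [heq]
  refine MeasurableSet.iUnion fun g => MeasurableSet.iUnion fun a =>
    MeasurableSet.iUnion fun b => ?_
  have hv : ∀ s, Measurable fun p : ((Fin T → ι → ℝ) × (Fin T → κ → ℝ) × (Fin T → ℝ)) ×
      (Fin T → ℝ) => designVec (Matrix.of p.1.1) (Matrix.of p.1.2.1) p.1.2.2 g (fun j => a j)
        (fun j => b j) s := by
    intro s
    simp only [designVec, mulVec, dotProduct, of_apply]
    refine Measurable.add (by fun_prop) (Measurable.ite ?_ (by fun_prop) measurable_const)
    exact measurableSet_le (by fun_prop) measurable_const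
  refine measurableSet_lt ?_ ?_
  · simp only [dotProduct]
    exact (Finset.measurable_sum _ fun s _ => (hv s).mul (hv s)).const_mul _
  · simp only [dotProduct]
    exact (Finset.measurable_sum _ fun s _ => (hv s).mul (by fun_prop)).pow_const 2

variable {Ω : Type*} [MeasurableSpace Ω] {μ : Measure Ω} [IsProbabilityMeasure μ]

/-- The bound for a fixed design carries over to a random design independent of the errors. -/
lemma measure_exceptionalSet_le_of_indepFun {C M k : ℝ} (hk : 0 < k) (hM : 0 ≤ M) (hC : 0 ≤ C)
    (hT : 0 < T) {Z : Ω → (Fin T → ι → ℝ) × (Fin T → κ → ℝ) × (Fin T → ℝ)} {e : Ω → Fin T → ℝ}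
    (hZ : Measurable Z) (he : Measurable e) (hind : IndepFun Z e μ)
    (h2 : ∀ a : Fin T → ℝ,
      ∫⁻ ω, ENNReal.ofReal ((a ⬝ᵥ e ω) ^ 2) ∂μ ≤ ENNReal.ofReal (C * (a ⬝ᵥ a)))
    (h4 : ∀ s, ∫⁻ ω, ENNReal.ofReal (e ω s ^ 4) ∂μ ≤ ENNReal.ofReal M) :
    μ {ω | e ω ∈ exceptionalSet (k * T) (Matrix.of (Z ω).1) (Matrix.of (Z ω).2.1) (Z ω).2.2} ≤
      ENNReal.ofReal ((8 * Fintype.card (ι ⊕ κ) * C / k + 128 * M / k ^ 2) / Real.sqrt T) := by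
  have : IsProbabilityMeasure (μ.map Z) := Measure.isProbabilityMeasure_map hZ.aemeasurable
  have hB := measurableSet_exceptionalSet (T := T) (ι := ι) (κ := κ) (k * T)
  set B := {p : ((Fin T → ι → ℝ) × (Fin T → κ → ℝ) × (Fin T → ℝ)) × (Fin T → ℝ) |
      p.2 ∈ exceptionalSet (k * T) (Matrix.of p.1.1) (Matrix.of p.1.2.1) p.1.2.2}
  have hprod := (indepFun_iff_map_prod_eq_prod_map_map hZ.aemeasurable he.aemeasurable).1 hind
  have h1 : μ {ω | e ω ∈ exceptionalSet (k * T) (Matrix.of (Z ω).1) (Matrix.of (Z ω).2.1)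
      (Z ω).2.2} =
      (μ.map Z).prod (μ.map e) B := by
    rw [← hprod, Measure.map_apply (hZ.prodMk he) hB]
    rfl
  rw [h1, Measure.prod_apply hB]
  have h2' : ∀ a : Fin T → ℝ, ∫⁻ x, ENNReal.ofReal ((a ⬝ᵥ x) ^ 2) ∂(μ.map e) ≤
      ENNReal.ofReal (C * (a ⬝ᵥ a)) := by
    intro a
    have hm : Measurable fun x : Fin T → ℝ => ENNReal.ofReal ((a ⬝ᵥ x) ^ 2) := by
      simp only [dotProduct]; fun_prop
    rw [lintegral_map hm he]
    exact h2 a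
  have h4' : ∀ s, ∫⁻ x, ENNReal.ofReal (x s ^ 4) ∂(μ.map e) ≤ ENNReal.ofReal M := by
    intro s
    have hm : Measurable fun x : Fin T → ℝ => ENNReal.ofReal (x s ^ 4) := by fun_prop
    rw [lintegral_map hm he]
    exact h4 s
  have hslice : ∀ z, μ.map e (Prod.mk z ⁻¹' B) ≤
      ENNReal.ofReal ((8 * Fintype.card (ι ⊕ κ) * C / k + 128 * M / k ^ 2) / Real.sqrt T) :=
    fun z => measure_exceptionalSet_le hk hM hC hT h2' h4' (Matrix.of z.1) (Matrix.of z.2.1) z.2.2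
  exact (lintegral_mono hslice).trans (by simp)

end RandomDesign

/-! ### The idiosyncratic part of the error -/

section ErrorMoments

variable {Ω : Type*} [MeasurableSpace Ω] {m K r : ℕ} {μ : Measure Ω} [IsProbabilityMeasure μ]
  {D : Model Ω m K r}

lemma Errors.memLp_four (h : Errors μ D) (i : ℕ) (t : ℤ) : MemLp (D.ε i t) 4 μ := by
  obtain ⟨κ, hκ, hm⟩ := h.moment
  refine (hm i t).mono_exponent ?_
  rw [show (4 : ℝ≥0∞) = ENNReal.ofReal 4 by simp]
  exact ENNReal.ofReal_le_ofReal (by linarith)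

lemma Errors.memLp_two (h : Errors μ D) (i : ℕ) (t : ℤ) : MemLp (D.ε i t) 2 μ :=
  (h.memLp_four i t).mono_exponent (by norm_num)

lemma Errors.integral_eq_zero (hmeas : MeasurableData D) (h : Errors μ D) (i : ℕ) (t : ℤ) :
    ∫ ω, D.ε i t ω ∂μ = 0 :=
  integral_eq_zero_of_condExp_ae_eq_zero (iSup_le fun _ => (hmeas.ε _ _).comap_le)
    (h.cond_mean (i + 1) i t (Nat.lt_succ_self i))

lemma Errors.exists_fourth_moment_le (hmeas : MeasurableData D) (h : Errors μ D) (i : ℕ) :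
    ∃ M, 0 ≤ M ∧ ∀ t, ∫⁻ ω, ENNReal.ofReal (D.ε i t ω ^ 4) ∂μ ≤ ENNReal.ofReal M := by
  have hpos : ∀ x : ℝ, 0 ≤ x ^ 4 := fun x => by positivity
  refine ⟨∫ ω, D.ε i 0 ω ^ 4 ∂μ, integral_nonneg fun ω => hpos _, fun t => ?_⟩
  have hm : Measurable fun x : ℝ => ENNReal.ofReal (x ^ 4) := by fun_prop
  have hint : Integrable (fun ω => D.ε i 0 ω ^ 4) μ := by
    have := (h.memLp_four i 0).integrable_norm_pow (p := 4) (by norm_num)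
    refine this.congr (ae_of_all _ fun ω => ?_)
    simp only [Real.norm_eq_abs]
    exact Even.pow_abs (by decide) _
  rw [ofReal_integral_eq_lintegral_ofReal hint (ae_of_all _ fun ω => hpos _),
    ← lintegral_map hm (hmeas.ε i t), (h.stationary i).map_eq (hmeas.ε i) t,
    lintegral_map hm (hmeas.ε i 0)]

/-- Absolutely summable autocovariances bound the variance of a linear combination of the errors
by the squared length of its coefficients. -/
lemma Errors.exists_variance_le (hmeas : MeasurableData D) (h : Errors μ D) (i : ℕ) :
    ∃ C, 0 ≤ C ∧ ∀ (T : ℕ) (a : Fin T → ℝ),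
      ∫⁻ ω, ENNReal.ofReal ((a ⬝ᵥ fun s => D.ε i (Model.time s) ω) ^ 2) ∂μ ≤
        ENNReal.ofReal (C * (a ⬝ᵥ a)) := by
  obtain ⟨C, hC⟩ := h.autocov_bdd
  obtain ⟨hsum, hle⟩ := hC i
  refine ⟨C, (tsum_nonneg fun _ => abs_nonneg _).trans hle, fun T a => ?_⟩
  set c : ℤ → ℝ := fun s => covariance (D.ε i 0) (D.ε i s) μ
  have hL : ∀ s : Fin T, MemLp (fun ω => a s * D.ε i (Model.time s) ω) 2 μ :=
    fun s => (h.memLp_two i _).const_mul _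
  have hmem : MemLp (fun ω => a ⬝ᵥ fun s => D.ε i (Model.time s) ω) 2 μ := by
    simp only [dotProduct]
    exact memLp_finsetSum _ fun s _ => hL s
  have h0 : ∫ ω, (a ⬝ᵥ fun s => D.ε i (Model.time s) ω) ∂μ = 0 := by
    simp only [dotProduct]
    rw [integral_finsetSum _ fun s _ => (hL s).integrable (by norm_num)]
    simp [integral_const_mul, h.integral_eq_zero hmeas]
  rw [lintegral_ofReal_sq hmem h0]
  refine ENNReal.ofReal_le_ofReal ?_
  have hrow : ∀ φ : Fin T → ℤ, Function.Injective φ → ∑ s, |c (φ s)| ≤ C := by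
    intro φ hφ
    refine le_trans ?_ hle
    have := hsum.sum_le_tsum (Finset.univ.map ⟨φ, hφ⟩) (fun _ _ => abs_nonneg _)
    simpa using this
  have htime : Function.Injective (Model.time (T := T)) := by
    intro s t hst
    simp only [Model.time] at hst
    exact Fin.ext (by omega)
  have hvar : variance (fun ω => a ⬝ᵥ fun s => D.ε i (Model.time s) ω) μ =
      ∑ s : Fin T, ∑ t : Fin T, a s * a t * c (Model.time t - Model.time s) := by
    simp only [dotProduct]
    rw [variance_fun_sum hL]
    refine Finset.sum_congr rfl fun s _ => Finset.sum_congr rfl fun t _ => ?_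
    rw [covariance_const_mul_left, covariance_const_mul_right, ← mul_assoc]
    congr 1
    exact (h.stationary i).covariance_eq (hmeas.ε i) measurable_id measurable_id _ _
  rw [hvar]
  calc ∑ s : Fin T, ∑ t : Fin T, a s * a t * c (Model.time t - Model.time s)
      ≤ ∑ s : Fin T, ∑ t : Fin T, (a s ^ 2 / 2 * |c (Model.time t - Model.time s)| +
          a t ^ 2 / 2 * |c (Model.time t - Model.time s)|) := by
        refine Finset.sum_le_sum fun s _ => Finset.sum_le_sum fun t _ => ?_
        set d := c (Model.time t - Model.time s)
        have h1 : a s * a t * d ≤ |a s * a t| * |d| := by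
          rw [← abs_mul]; exact le_abs_self _
        have h2 : |a s * a t| ≤ a s ^ 2 / 2 + a t ^ 2 / 2 := by
          rw [abs_le]
          constructor <;> nlinarith [sq_nonneg (a s + a t), sq_nonneg (a s - a t)]
        nlinarith [abs_nonneg d]
    _ = ∑ s : Fin T, a s ^ 2 / 2 * ∑ t : Fin T, |c (Model.time t - Model.time s)| +
        ∑ t : Fin T, a t ^ 2 / 2 * ∑ s : Fin T, |c (Model.time t - Model.time s)| := by
        simp only [Finset.sum_add_distrib, Finset.mul_sum]
        congr 1
        exact Finset.sum_comm
    _ ≤ ∑ s : Fin T, a s ^ 2 / 2 * C + ∑ t : Fin T, a t ^ 2 / 2 * C := by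
        refine add_le_add (Finset.sum_le_sum fun s _ => mul_le_mul_of_nonneg_left
          (hrow _ fun x y hxy => htime ?_) (by positivity))
          (Finset.sum_le_sum fun t _ => mul_le_mul_of_nonneg_left
            (hrow _ fun x y hxy => htime ?_) (by positivity))
        · simpa using hxy
        · simpa using hxy
    _ = C * (a ⬝ᵥ a) := by
        rw [← Finset.sum_add_distrib, dotProduct, Finset.mul_sum]
        exact Finset.sum_congr rfl fun s _ => by ring

/-- The projections of the errors on the column spaces of the designs are negligible, uniformly in
the threshold. -/
lemma tendsto_error_part (hmeas : MeasurableData D) (hexog : ExogenousThreshold μ D)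
    (h : Errors μ D) (i : ℕ) {k : ℝ} (hk : 0 < k) :
    Tendsto (fun n : ℕ × ℕ => μ {ω | ∃ γ a b c d,
      k * n.2 * ((D.Xbar n.1 n.2 ω *ᵥ a + D.Xmat i n.2 ω *ᵥ b + D.Wmat i n.2 (D.γ i) ω *ᵥ c +
          D.Wmat i n.2 γ ω *ᵥ d) ⬝ᵥ (D.Xbar n.1 n.2 ω *ᵥ a + D.Xmat i n.2 ω *ᵥ b +
          D.Wmat i n.2 (D.γ i) ω *ᵥ c + D.Wmat i n.2 γ ω *ᵥ d)) <
        ((D.Xbar n.1 n.2 ω *ᵥ a + D.Xmat i n.2 ω *ᵥ b + D.Wmat i n.2 (D.γ i) ω *ᵥ c +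
          D.Wmat i n.2 γ ω *ᵥ d) ⬝ᵥ fun s => D.ε i (Model.time s) ω) ^ 2}) atTop (𝓝 0) := by
  obtain ⟨C, hC0, hC⟩ := h.exists_variance_le hmeas i
  obtain ⟨M, hM0, hM⟩ := h.exists_fourth_moment_le hmeas i
  set B := 8 * Fintype.card ((Fin K ⊕ Fin K ⊕ Fin r) ⊕ Fin r) * C / k + 128 * M / k ^ 2
  have hsnd : Tendsto (fun n : ℕ × ℕ => n.2) atTop atTop := by
    rw [← prod_atTop_atTop_eq]; exact tendsto_snd
  have hlim : Tendsto (fun n : ℕ × ℕ => ENNReal.ofReal (B / Real.sqrt n.2)) atTop (𝓝 0) := by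
    have h1 : Tendsto (fun n : ℕ × ℕ => Real.sqrt n.2) atTop atTop :=
      Real.tendsto_sqrt_atTop.comp (tendsto_natCast_atTop_atTop.comp hsnd)
    simpa using ENNReal.tendsto_ofReal (h1.const_div_atTop B)
  refine tendsto_of_tendsto_of_tendsto_of_le_of_le' tendsto_const_nhds hlim
    (Eventually.of_forall fun _ => zero_le) ?_
  filter_upwards [hsnd.eventually_gt_atTop 0] with n hT
  -- the regressors as functions of the factors and the idiosyncratic parts
  let xf : ℕ → ℤ → ((ℤ → Fin m → ℝ) × (ℕ → ℤ → Fin K → ℝ) × (ℤ → ℝ)) → Fin K → ℝ :=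
    fun j t p a => ((D.Pi j)ᵀ *ᵥ p.1 t) a + p.2.1 j t a
  let wf : ℤ → ((ℤ → Fin m → ℝ) × (ℕ → ℤ → Fin K → ℝ) × (ℤ → ℝ)) → Fin r → ℝ :=
    fun t p a => (D.Rᵀ *ᵥ xf i t p) a
  let Z : ((ℤ → Fin m → ℝ) × (ℕ → ℤ → Fin K → ℝ) × (ℤ → ℝ)) →
      (Fin n.2 → (Fin K ⊕ Fin K ⊕ Fin r) → ℝ) × (Fin n.2 → Fin r → ℝ) × (Fin n.2 → ℝ) :=
    fun p => (fun s j => Sum.elim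
        (fun a => (n.1 : ℝ)⁻¹ * ∑ j ∈ Finset.range n.1, xf j (Model.time s) p a)
        (Sum.elim (fun a => xf i (Model.time s) p a)
          (fun a => if p.2.2 (Model.time s) ≤ D.γ i then wf (Model.time s) p a else 0)) j,
      fun s a => wf (Model.time s) p a, fun s => p.2.2 (Model.time s))
  have hxf : ∀ j t a, Measurable fun p => xf j t p a := by
    intro j t a
    simp only [xf, mulVec, dotProduct]
    fun_prop
  have hwf : ∀ t a, Measurable fun p => wf t p a := by
    intro t a
    simp only [wf, mulVec, dotProduct]
    exact Finset.measurable_sum _ fun b _ => (hxf i t b).const_mul _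
  have hZ : Measurable Z := by
    refine Measurable.prodMk ?_ (Measurable.prodMk ?_ (by fun_prop))
    · refine measurable_pi_iff.2 fun s => measurable_pi_iff.2 fun j => ?_
      rcases j with a | a | a
      · exact (Finset.measurable_sum _ fun j _ => hxf j _ a).const_mul _
      · exact hxf i _ a
      · exact Measurable.ite (measurableSet_le (by fun_prop) measurable_const) (hwf _ a)
          measurable_const
    · exact measurable_pi_iff.2 fun s => measurable_pi_iff.2 fun a => hwf _ a
  let P : Ω → (ℤ → Fin m → ℝ) × (ℕ → ℤ → Fin K → ℝ) × (ℤ → ℝ) :=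
    fun ω => ((fun t => D.f t ω), (fun j t => D.ξ j t ω), (fun t => D.q i t ω))
  have hP : Measurable P :=
    (measurable_pi_iff.2 hmeas.f).prodMk ((measurable_pi_iff.2 fun j =>
      measurable_pi_iff.2 (hmeas.ξ j)).prodMk (measurable_pi_iff.2 (hmeas.q i)))
  let e : Ω → Fin n.2 → ℝ := fun ω s => D.ε i (Model.time s) ω
  have he : Measurable e := measurable_pi_iff.2 fun s => hmeas.ε i _
  have hrestr : Measurable fun (x : ℤ → ℝ) (s : Fin n.2) => x (Model.time s) := by fun_prop
  have hind : IndepFun (Z ∘ P) e μ := (hexog i).comp hZ hrestr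
  refine le_trans (measure_mono ?_) (measure_exceptionalSet_le_of_indepFun hk hM0 hC0 hT
    (hZ.comp hP) he hind (hC n.2) (fun s => hM _))
  rintro ω ⟨γ, a, b, c, d, hω⟩
  have hdesign : designVec (Matrix.of (Z (P ω)).1) (Matrix.of (Z (P ω)).2.1) (Z (P ω)).2.2 γ
      (Sum.elim a (Sum.elim b c)) d = D.Xbar n.1 n.2 ω *ᵥ a + D.Xmat i n.2 ω *ᵥ b +
        D.Wmat i n.2 (D.γ i) ω *ᵥ c + D.Wmat i n.2 γ ω *ᵥ d := by
    have hxb : ∀ s a, (n.1 : ℝ)⁻¹ * ∑ j ∈ Finset.range n.1, xf j (Model.time s) (P ω) a =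
        D.Xbar n.1 n.2 ω s a := by
      intro s a
      rw [Model.Xbar, Matrix.smul_apply, Matrix.sum_apply]
      rfl
    have hw : ∀ (g : ℝ) (s : Fin n.2) (a : Fin r),
        (if (P ω).2.2 (Model.time s) ≤ g then wf (Model.time s) (P ω) a else 0) =
        D.Wmat i n.2 g ω s a := by
      intro g s a
      simp only [Model.Wmat, Model.w, of_apply]
      split_ifs <;> rfl
    ext s
    simp only [designVec, mulVec, dotProduct, of_apply, Fintype.sum_sum_type, Z, Sum.elim_inl,
      Sum.elim_inr, hxb, hw, Pi.add_apply]
    have hlast : (if (P ω).2.2 (Model.time s) ≤ γ then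
        ∑ a, wf (Model.time s) (P ω) a * d a else 0) = ∑ a, D.Wmat i n.2 γ ω s a * d a := by
      simp only [← hw]
      split_ifs <;> simp
    rw [hlast, ← add_assoc]
    rfl
  refine ⟨γ, Sum.elim a (Sum.elim b c), d, ?_⟩
  simp only [Function.comp_apply]
  rw [hdesign]
  exact hω

end ErrorMoments

end PanelThreshold

end

theorem theorem1 {Ω : Type*} [MeasurableSpace Ω] (μ : Measure Ω) [IsProbabilityMeasure μ]
    {m K r : ℕ} (D : PanelThreshold.Model Ω m K r)
    (hmeas : PanelThreshold.MeasurableData D)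
    (hfactors : PanelThreshold.CommonFactors μ D)
    (hloadings : PanelThreshold.FactorLoadings D)
    (hregressors : PanelThreshold.Regressors μ D)
    (herrors : PanelThreshold.Errors μ D)
    (hexog : PanelThreshold.ExogenousThreshold μ D)
    (hcont : PanelThreshold.ContinuousThreshold μ D)
    (hident : PanelThreshold.Identification μ D)
    (hspace : PanelThreshold.ThresholdSpace D)
    (hrank : PanelThreshold.FullRank μ D)
    (hmoments : PanelThreshold.BoundedMoments μ D)
    (i : ℕ) (γhat : ℕ × ℕ → Ω → ℝ)
    (hγhat : ∀ n : ℕ × ℕ, ∀ᵐ ω ∂μ, D.IsThresholdEstimate i n.1 n.2 ω (γhat n ω)) :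
    TendstoInMeasure μ γhat atTop (fun _ => D.γ i) := by
  rw [tendstoInMeasure_iff_dist]
  intro η hη
  obtain ⟨τ, hτ, hid⟩ := hident.bound i
  have hδ : 0 < D.δ i ⬝ᵥ D.δ i := by
    refine (PanelThreshold.dotProduct_self_nonneg_real _).lt_of_ne fun h0 => hident.delta_ne i ?_
    exact dotProduct_self_eq_zero.1 h0.symm
  -- any constant below a sixteenth of the identified signal works in `ssr_lt_ssr`
  set k := τ * min 1 η * (D.δ i ⬝ᵥ D.δ i) / 32 with hk
  have hkpos : 0 < k := by positivity
  have hsnd : Tendsto (fun n : ℕ × ℕ => n.2) atTop atTop := by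
    rw [← prod_atTop_atTop_eq]; exact tendsto_snd
  have hlim := (((hid η hη).add (hrank.sample i)).add
    (PanelThreshold.tendsto_factor_part hmeas hloadings hregressors (D.lam i) hkpos)).add
    (PanelThreshold.tendsto_error_part hmeas hexog herrors i hkpos)
  simp only [add_zero] at hlim
  refine tendsto_of_tendsto_of_tendsto_of_le_of_le' tendsto_const_nhds hlim
    (Eventually.of_forall fun _ => zero_le) ?_
  filter_upwards [hsnd.eventually_gt_atTop 0] with n hT
  refine le_trans (measure_mono_ae ?_) ((measure_union_le _ _).trans (add_le_add_left
    ((measure_union_le _ _).trans (add_le_add_left (measure_union_le _ _) _)) _))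
  filter_upwards [hγhat n] with ω hest hω
  by_contra hcon
  change ¬ (ω ∈ (_ ∪ _ ∪ _ ∪ _ : Set Ω)) at hcon
  change η ≤ |γhat n ω - D.γ i| at hω
  simp only [Set.mem_union, Set.mem_ofPred_eq, not_or, not_not, not_exists, not_lt] at hcon
  obtain ⟨⟨⟨hlmin, hpos⟩, hfac⟩, herr⟩ := hcon
  refine absurd (hest.2 _ (hspace i)) (not_le.2 ?_)
  refine D.ssr_lt_ssr i n.1 n.2 (γhat n ω) ω hkpos hT (hpos _ (hspace i)) (hpos _ hest.1) ?_ hfac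
    (herr _)
  have h1 : τ * min 1 η ≤ _ :=
    (mul_le_mul_of_nonneg_left (min_le_min_left 1 hω) hτ.le).trans (hlmin _ hest.1 hω)
  have h2 := mul_le_mul_of_nonneg_right h1 hδ.le
  refine lt_of_lt_of_le ?_ h2
  rw [hk] at hkpos ⊢
  linarith
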